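/- Let $K\ge 1$ and let $Q=(q_{ij})$ be the generator of an irreducible continuous-time Markov chain (CTMC) on $\{1,\dots,K\}$ with stationary distribution $\pi=(\pi_1,\dots,\pi_K)$, and assume that the chain is time-reversible: $\pi_i q_{ij}=\pi_j q_{ji}$ for all $i\ne j$. Put $\Pi=\mathrm{diag}(\pi_1,\dots,\pi_K)$ and $S=\Pi^{1/2}Q\,\Pi^{-1/2}$, let $U$ be an orthogonal matrix with $U^{T}SU=\mathrm{diag}(-d_1,\dots,-d_{K-1},0)$, and let $T=\Pi^{-1/2}U=(t_{ij})$ and $T^{-1}=(\tilde t_{ij})$. For $1\le j\le K-1$ put $$b_j=\sum_{i=1}^K\pi_i^2t_{ij}^2,\qquad a_j=b_jd_j .$$ Let $X(t)$, $t\ge 0$, be a CTMC with generator $Q$ and arbitrary initial law, sampled at the points of an independent Poisson process of rate $\lambda>0$. Let $\tilde X(t)=X(t')$, where $t'$ is the latest sampling time up to time $t$ (before the first sample, $\tilde X$ is an arbitrary random initial estimate). In the fresh-when-equal (FWE) model the freshness process is $F(t)=1$ if $\tilde X(t)=X(t)$ and $F(t)=0$ otherwise. The mean freshness $f(\lambda)$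 is the steady-state probability $\lim_{t\to\infty}\mathbb P[\tilde X(t)=X(t)]$, which is also the almost sure long-run time average $\lim_{\tau\to\infty}\frac1\tau\int_0^\tau F(t)\,dt$. Then both limits exist and coincide, their common value $f(\lambda)$ depends only on $Q$ and $\lambda$, and for every $\lambda>0$ $$f(\lambda)=\sum_{j=1}^K\pi_j^2+\lambda\sum_{j=1}^{K-1}\frac{b_j}{\lambda+d_j}=1-\sum_{j=1}^{K-1}\frac{a_j}{\lambda+d_j}.$$ Moreover, for $1\le j\le K-1$, $b_j=\sum_{i=1}^K\tilde t_{ji}^{\,2}$ and $d_j,b_j,a_j>0$. The function $f$ has a continuous derivative on $(0,\infty)$, $\lim_{\lambda\to0^+}f(\lambda)=\sum_{j=1}^K\pi_j^2$, and if $K\ge2$, then $f$ is strictly increasing and strictly concave on $(0,\infty)$. -/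

import Mathlib

open MeasureTheory ProbabilityTheory Filter Topology Matrix
open scoped NNReal

universe u

noncomputable section

namespace SampledCTMC

/-! ### Generators of finite-state continuous-time Markov chains -/

section Generator

variable {S : Type*} [Fintype S] [DecidableEq S]

/-- `Q` is an infinitesimal generator: nonnegative off-diagonal rates and zero row sums. -/
structure IsGenerator (Q : Matrix S S ℝ) : Prop where
  nonneg_off_diag : ∀ i j, i ≠ j → 0 ≤ Q i j
  row_sum : ∀ i, ∑ j, Q i j = 0

/-- The transition probability `P_t(i, j)`, an entry of the matrix `exp (t Q)`. -/
def transitionProb (Q : Matrix S S ℝ) (t : ℝ≥0) (i j : S) : ℝ :=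
  NormedSpace.exp ((t : ℝ) • Q) i j

/-- From any state one gets to any other state in some finite time with positive probability. -/
def IsIrreducible (Q : Matrix S S ℝ) : Prop :=
  ∀ i j, ∃ t : ℝ≥0, 0 < transitionProb Q t i j

/-- `p` is a stationary distribution: a probability vector satisfying global balance `p Q = 0`. -/
structure IsStationary (Q : Matrix S S ℝ) (p : S → ℝ) : Prop where
  nonneg : ∀ i, 0 ≤ p i
  sum_eq_one : ∑ i, p i = 1
  balance : p ᵥ* Q = 0

/-- Time-reversibility, through the detailed balance equations. -/
def IsReversible (Q : Matrix S S ℝ) (p : S → ℝ) : Prop :=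
  ∀ i j, i ≠ j → p i * Q i j = p j * Q j i

/-- The symmetrized generator `Π^{1/2} Q Π^{-1/2}`, with `Π = diag p`. -/
def symmetrizedGenerator (Q : Matrix S S ℝ) (p : S → ℝ) : Matrix S S ℝ :=
  diagonal (fun i => √(p i)) * Q * diagonal (fun i => (√(p i))⁻¹)

/-- The diagonalizing matrix `T = Π^{-1/2} U`, with `Π = diag p`. -/
def diagonalizer (p : S → ℝ) (U : Matrix S S ℝ) : Matrix S S ℝ :=
  diagonal (fun i => (√(p i))⁻¹) * U

end Generator

/-! ### The processes -/

section Processes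

variable {S : Type*} [Fintype S] [DecidableEq S] [MeasurableSpace S]
variable {Ω : Type*} [MeasurableSpace Ω]

/-- `X` is a continuous-time Markov chain with generator `Q` (and arbitrary initial law): it has
right-continuous paths, and the conditional probability of `X s = j` given the values of `X` at
times `t 0 ≤ ⋯ ≤ t m ≤ s` is `P_{s - t m}(X (t m), j)`. -/
structure IsCTMC (P : Measure Ω) (Q : Matrix S S ℝ) (X : ℝ≥0 → Ω → S) : Prop where
  measurable : ∀ t, Measurable (X t)
  right_continuous : ∀ ω t, ∀ᶠ s in 𝓝[>] t, X s ω = X t ω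
  markov : ∀ (m : ℕ) (t : Fin (m + 1) → ℝ≥0), Monotone t →
    ∀ (i : Fin (m + 1) → S) (s : ℝ≥0), t (Fin.last m) ≤ s → ∀ j : S,
      P.real {ω | (∀ k, X (t k) ω = i k) ∧ X s ω = j} =
        P.real {ω | ∀ k, X (t k) ω = i k} *
          transitionProb Q (s - t (Fin.last m)) (i (Fin.last m)) j

/-- `N` is the counting process of a Poisson process with intensity `r`. -/
structure IsPoissonProcess (P : Measure Ω) (r : ℝ≥0) (N : ℝ≥0 → Ω → ℕ) : Prop where
  measurable : ∀ t, Measurable (N t)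
  zero : ∀ ω, N 0 ω = 0
  mono : ∀ ω, Monotone (fun t => N t ω)
  right_continuous : ∀ ω t, ∀ᶠ s in 𝓝[>] t, N s ω = N t ω
  indep_increments : HasIndepIncrements N P
  law_increment : ∀ s t, s ≤ t →
    HasLaw (fun ω => N t ω - N s ω) (poissonMeasure (r * (t - s))) P

/-- `s` is a sampling time: the counting process `N` jumps at `s`. -/
def IsSamplingTime (N : ℝ≥0 → Ω → ℕ) (ω : Ω) (s : ℝ≥0) : Prop :=
  0 < s ∧ ∀ r < s, N r ω < N s ω

/-- The latest sampling time not after `t` (if there is one). -/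
def latestSamplingTime (N : ℝ≥0 → Ω → ℕ) (t : ℝ≥0) (ω : Ω) : ℝ≥0 :=
  sSup {s | s ≤ t ∧ IsSamplingTime N ω s}

open Classical in
/-- The martingale estimator: the state of `X` at the latest sampling time, and an
initial guess `x₀` as long as no sample has been taken. -/
def estimator (X : ℝ≥0 → Ω → S) (N : ℝ≥0 → Ω → ℕ) (x₀ : Ω → S) (t : ℝ≥0) (ω : Ω) : S :=
  if ∃ s ≤ t, IsSamplingTime N ω s then X (latestSamplingTime N t ω) ω else x₀ ω

/-- The fresh-when-equal freshness process: `1` if estimator and source agree, else `0`. -/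
def freshness (X : ℝ≥0 → Ω → S) (N : ℝ≥0 → Ω → ℕ) (x₀ : Ω → S) (t : ℝ≥0) (ω : Ω) : ℝ :=
  if estimator X N x₀ t ω = X t ω then 1 else 0

/-- A Markov chain `X` with generator `Q`, sampled at the points of an independent Poisson process
`N` of intensity `r`, with an arbitrary (random) initial estimate `x₀`. -/
structure IsPoissonSampled (P : Measure Ω) (Q : Matrix S S ℝ) (r : ℝ≥0)
    (X : ℝ≥0 → Ω → S) (N : ℝ≥0 → Ω → ℕ) (x₀ : Ω → S) : Prop where
  chain : IsCTMC P Q X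
  poisson : IsPoissonProcess P r N
  indep : IndepFun (fun ω t => X t ω) (fun ω t => N t ω) P
  measurable_init : Measurable x₀

/-- `m` is the mean freshness `E[F]`: the steady-state probability `lim P[X̃(t) = X(t)]` exists and
equals `m`, and almost surely so does the long-run time average of the freshness process. -/
structure IsMeanFreshness (P : Measure Ω) (X : ℝ≥0 → Ω → S) (N : ℝ≥0 → Ω → ℕ) (x₀ : Ω → S)
    (m : ℝ) : Prop where
  steady_state : Tendsto (fun t => P.real {ω | estimator X N x₀ t ω = X t ω}) atTop (𝓝 m)
  time_average : ∀ᵐ ω ∂P,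
    Tendsto (fun τ : ℝ => τ⁻¹ * ∫ t in (0 : ℝ)..τ, freshness X N x₀ t.toNNReal ω) atTop (𝓝 m)

end Processes

end SampledCTMC

end

/-!
In the long run the age of the latest sample is exponential of rate `r` and independent of the
chain, so the mean freshness is the expectation of the stationary return probability
`∑ i, p i * P_v(i, i)` at an exponential time `v`. Detailed balance diagonalizes the generator,
which makes the return probability a mixture of exponentials `exp (-d j * v)` with weights `b j`;
averaging over `v` turns each of them into `r / (r + d j)`.

For the time average, exponential mixing of the chain and forgetfulness of the sampling process make
the covariances of the freshness process decay exponentially. Its centred integral up to time `τ`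
therefore has second moment `O(τ)`, which gives almost sure convergence along the squares, and
boundedness fills the gaps between consecutive squares.
-/

namespace SampledCTMC

section DirichletForm

variable {S : Type*} [Fintype S] {Q : Matrix S S ℝ} {p : S → ℝ}

theorem IsStationary.le_one (hp : IsStationary Q p) (i : S) : p i ≤ 1 :=
  hp.sum_eq_one ▸ Finset.single_le_sum (fun j _ => hp.nonneg j) (Finset.mem_univ i)

/-- The Dirichlet form of the chain with generator `Q` and stationary distribution `p`. -/
noncomputable def dirichletForm (Q : Matrix S S ℝ) (p f : S → ℝ) : ℝ :=
  1 / 2 * ∑ i, ∑ j, p i * Q i j * (f i - f j) ^ 2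

theorem IsGenerator.sum_mul_mulVec (hQ : IsGenerator Q) (hp : IsStationary Q p) (f : S → ℝ) :
    ∑ i, p i * f i * (Q *ᵥ f) i = -dirichletForm Q p f := by
  have hrow : ∑ i, ∑ j, p i * Q i j * f i ^ 2 = 0 := by
    refine Finset.sum_eq_zero fun i _ => ?_
    simp only [mul_right_comm _ (Q i _), ← Finset.mul_sum, hQ.row_sum, mul_zero]
  have hcol : ∑ i, ∑ j, p i * Q i j * f j ^ 2 = 0 := by
    rw [Finset.sum_comm]
    refine Finset.sum_eq_zero fun j _ => ?_
    have hbal : ∑ i, p i * Q i j = 0 := congrFun hp.balance j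
    rw [← Finset.sum_mul, hbal, zero_mul]
  have hcross : ∑ i, p i * f i * (Q *ᵥ f) i = ∑ i, ∑ j, p i * Q i j * (f i * f j) := by
    refine Finset.sum_congr rfl fun i _ => ?_
    rw [Matrix.mulVec, dotProduct, Finset.mul_sum]
    exact Finset.sum_congr rfl fun j _ => by ring
  have hsquare : ∑ i, ∑ j, p i * Q i j * (f i - f j) ^ 2 =
      ∑ i, ∑ j, p i * Q i j * f i ^ 2 - 2 * ∑ i, ∑ j, p i * Q i j * (f i * f j)
        + ∑ i, ∑ j, p i * Q i j * f j ^ 2 := by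
    simp only [Finset.mul_sum, ← Finset.sum_add_distrib, ← Finset.sum_sub_distrib]
    exact Finset.sum_congr rfl fun i _ => Finset.sum_congr rfl fun j _ => by ring
  rw [dirichletForm, hcross, hsquare, hrow, hcol]
  ring

theorem IsGenerator.dirichletForm_term_nonneg (hQ : IsGenerator Q) (hp : ∀ i, 0 ≤ p i)
    (f : S → ℝ) (i j : S) : 0 ≤ p i * Q i j * (f i - f j) ^ 2 := by
  obtain rfl | hij := eq_or_ne i j
  · simp
  · exact mul_nonneg (mul_nonneg (hp i) (hQ.nonneg_off_diag i j hij)) (sq_nonneg _)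

theorem IsGenerator.dirichletForm_nonneg (hQ : IsGenerator Q) (hp : ∀ i, 0 ≤ p i)
    (f : S → ℝ) : 0 ≤ dirichletForm Q p f :=
  mul_nonneg (by norm_num) <| Finset.sum_nonneg fun i _ => Finset.sum_nonneg fun j _ =>
    hQ.dirichletForm_term_nonneg hp f i j

end DirichletForm

section Spectral

variable {S : Type*} [Fintype S] [DecidableEq S] {Q : Matrix S S ℝ} {p : S → ℝ}

theorem transitionProb_zero (i j : S) : transitionProb Q 0 i j = (1 : Matrix S S ℝ) i j := by
  simp [transitionProb]

open scoped Matrix.Norms.Operator in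
theorem continuous_transitionProb (Q : Matrix S S ℝ) (i j : S) :
    Continuous fun t : ℝ≥0 => transitionProb Q t i j := by
  have hexp : Continuous fun t : ℝ≥0 => NormedSpace.exp ((t : ℝ) • Q) :=
    NormedSpace.exp_continuous.comp (NNReal.continuous_coe.smul continuous_const)
  exact hexp.matrix_elem i j

open scoped Matrix.Norms.Operator in
theorem semiconjBy_exp {A B D : Matrix S S ℝ} (h : SemiconjBy D A B) :
    SemiconjBy D (NormedSpace.exp A) (NormedSpace.exp B) :=
  h.exp_right

theorem IsReversible.mul_transitionProb (hrev : IsReversible Q p) (t : ℝ≥0) (i j : S) :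
    p i * transitionProb Q t i j = p j * transitionProb Q t j i := by
  have hsemi : SemiconjBy (diagonal p) ((t : ℝ) • Q) ((t : ℝ) • Q)ᵀ := by
    rw [transpose_smul]
    refine SemiconjBy.smul_right ?_ _
    ext k l
    obtain rfl | hkl := eq_or_ne k l
    · simp [mul_comm]
    · simp [hrev k l hkl, mul_comm]
  have hexp := congrFun₂ (semiconjBy_exp hsemi).eq i j
  rw [exp_transpose, diagonal_mul, mul_diagonal, transpose_apply] at hexp
  rw [transitionProb, hexp, mul_comm, transitionProb]

theorem IsStationary.pos (hp : IsStationary Q p) (hirr : IsIrreducible Q)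
    (hrev : IsReversible Q p) (i : S) : 0 < p i := by
  refine (hp.nonneg i).lt_of_ne' fun hi => ?_
  have hzero (j : S) : p j = 0 := by
    obtain ⟨t, ht⟩ := hirr j i
    have hbal := hrev.mul_transitionProb t i j
    rw [hi, zero_mul, eq_comm, mul_eq_zero] at hbal
    exact hbal.resolve_right ht.ne'
  simpa [hzero] using hp.sum_eq_one

theorem IsIrreducible.eq_of_mul_eq (hirr : IsIrreducible Q) {f : S → ℝ}
    (hf : ∀ i j, f i * Q i j = Q i j * f j) (i j : S) : f i = f j := by
  obtain ⟨t, ht⟩ := hirr i j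
  have hcomm : Commute (diagonal f) ((t : ℝ) • Q) := by
    refine Commute.smul_right ?_ _
    ext k l
    simp [hf]
  have hexp := congrFun₂ (semiconjBy_exp hcomm).eq i j
  rw [diagonal_mul, mul_diagonal, mul_comm] at hexp
  exact mul_left_cancel₀ ht.ne' hexp

theorem IsGenerator.eq_of_dirichletForm_eq_zero (hQ : IsGenerator Q) (hirr : IsIrreducible Q)
    (hpos : ∀ i, 0 < p i) {f : S → ℝ} (hf : dirichletForm Q p f = 0) (i j : S) : f i = f j := by
  have hnonneg := hQ.dirichletForm_term_nonneg (fun i => (hpos i).le) f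
  have hterm (k l : S) : p k * Q k l * (f k - f l) ^ 2 = 0 := by
    have hsum : ∑ k, ∑ l, p k * Q k l * (f k - f l) ^ 2 = 0 :=
      (mul_eq_zero.1 hf).resolve_left (by norm_num)
    rw [Finset.sum_eq_zero_iff_of_nonneg
      fun k _ => Finset.sum_nonneg fun l _ => hnonneg k l] at hsum
    exact (Finset.sum_eq_zero_iff_of_nonneg fun l _ => hnonneg k l).1
      (hsum k (Finset.mem_univ k)) l (Finset.mem_univ l)
  refine hirr.eq_of_mul_eq (fun k l => ?_) i j
  obtain hkl | hkl := mul_eq_zero.1 (hterm k l)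
  · rw [(mul_eq_zero.1 hkl).resolve_left (hpos k).ne', mul_zero, zero_mul]
  · rw [sub_eq_zero.1 (pow_eq_zero_iff two_ne_zero |>.1 hkl), mul_comm]

/-- The columns of `T` are eigenvectors of `Q` with eigenvalues `D`, and they are orthonormal for
the inner product weighted by `p`. -/
structure IsEigenbasis (Q : Matrix S S ℝ) (p : S → ℝ) (T : Matrix S S ℝ) (D : S → ℝ) : Prop where
  orthonormal : Tᵀ * diagonal p * T = 1
  eigen : Q * T = T * diagonal D

theorem isEigenbasis_diagonalizer {U : Matrix S S ℝ} {D : S → ℝ} (hpos : ∀ i, 0 < p i)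
    (hU : Uᵀ * U = 1) (hdiag : Uᵀ * symmetrizedGenerator Q p * U = diagonal D) :
    IsEigenbasis Q p (diagonalizer p U) D where
  orthonormal := by
    have hcancel : diagonal (fun i => (√(p i))⁻¹) * diagonal p * diagonal (fun i => (√(p i))⁻¹) =
        1 := by
      rw [diagonal_mul_diagonal, diagonal_mul_diagonal, ← diagonal_one]
      congr 1
      funext i
      rw [mul_right_comm, ← mul_inv, Real.mul_self_sqrt (hpos i).le, inv_mul_cancel₀ (hpos i).ne']
    rw [diagonalizer, transpose_mul, diagonal_transpose]
    simp only [Matrix.mul_assoc] at hcancel ⊢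
    rw [← Matrix.mul_assoc (diagonal p), ← Matrix.mul_assoc (diagonal _), hcancel, Matrix.one_mul,
      hU]
  eigen := by
    have hcancel : diagonal (fun i => (√(p i))⁻¹) * diagonal (fun i => √(p i)) =
        (1 : Matrix S S ℝ) := by
      rw [diagonal_mul_diagonal, ← diagonal_one]
      congr 1
      funext i
      exact inv_mul_cancel₀ (Real.sqrt_pos.2 (hpos i)).ne'
    calc Q * diagonalizer p U
        = (diagonal (fun i => (√(p i))⁻¹) * diagonal (fun i => √(p i))) * Q *
            diagonalizer p U := by rw [hcancel, Matrix.one_mul]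
      _ = diagonal (fun i => (√(p i))⁻¹) * (U * Uᵀ) * diagonal (fun i => √(p i)) * Q *
            diagonalizer p U := by rw [mul_eq_one_comm.1 hU, Matrix.mul_one]
      _ = diagonalizer p U * (Uᵀ * symmetrizedGenerator Q p * U) := by
        simp only [diagonalizer, symmetrizedGenerator, Matrix.mul_assoc]
      _ = diagonalizer p U * diagonal D := by rw [hdiag]

/-- The probability that the stationary chain is at time `t` in the state it started from. -/
noncomputable def returnProb (Q : Matrix S S ℝ) (p : S → ℝ) (t : ℝ≥0) : ℝ :=
  ∑ j, p j * transitionProb Q t j j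

/-- The coefficient `b_k` of `e^{D_k t}` in the spectral representation of the return probability
at time `t`. -/
noncomputable def returnWeight (p : S → ℝ) (T : Matrix S S ℝ) (k : S) : ℝ :=
  ∑ i, p i ^ 2 * T i k ^ 2

namespace IsEigenbasis

variable {T : Matrix S S ℝ} {D : S → ℝ} {k l : S}

theorem inv_eq (h : IsEigenbasis Q p T D) : T⁻¹ = Tᵀ * diagonal p :=
  inv_eq_left_inv h.orthonormal

theorem inv_apply (h : IsEigenbasis Q p T D) (k i : S) : T⁻¹ k i = p i * T i k := by
  rw [h.inv_eq, mul_diagonal, transpose_apply, mul_comm]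

theorem isUnit (h : IsEigenbasis Q p T D) : IsUnit T :=
  IsUnit.of_mul_eq_one _ (mul_eq_one_comm.1 h.orthonormal)

theorem sum_mul_mul (h : IsEigenbasis Q p T D) (k l : S) :
    ∑ i, p i * T i k * T i l = (1 : Matrix S S ℝ) k l := by
  rw [← h.orthonormal, mul_apply]
  simp only [mul_diagonal, transpose_apply, mul_comm (p _)]

theorem returnWeight_eq_sum_inv (h : IsEigenbasis Q p T D) (k : S) :
    returnWeight p T k = ∑ i, T⁻¹ k i ^ 2 := by
  simp only [returnWeight, h.inv_apply, mul_pow]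

theorem transitionProb_eq_sum (h : IsEigenbasis Q p T D) (t : ℝ≥0) (i j : S) :
    transitionProb Q t i j = ∑ k, p j * T i k * T j k * Real.exp (D k * t) := by
  have hconj : (t : ℝ) • Q = T * diagonal (fun k => D k * t) * T⁻¹ := by
    have hD : diagonal (fun k => D k * (t : ℝ)) = (t : ℝ) • diagonal D := by
      ext k l
      by_cases hkl : k = l <;> simp [hkl, mul_comm]
    rw [hD, Matrix.mul_smul, ← h.eigen, Matrix.smul_mul, Matrix.mul_assoc,
      mul_nonsing_inv _ ((isUnit_iff_isUnit_det _).1 h.isUnit), Matrix.mul_one]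
  rw [transitionProb, hconj, exp_conj _ _ h.isUnit, exp_diagonal, mul_apply]
  refine Finset.sum_congr rfl fun k _ => ?_
  rw [mul_diagonal, h.inv_apply, Pi.coe_exp, ← Real.exp_eq_exp_ℝ]
  ring

theorem returnProb_eq_sum (h : IsEigenbasis Q p T D) (t : ℝ≥0) :
    returnProb Q p t = ∑ k, returnWeight p T k * Real.exp (D k * t) := by
  simp only [returnProb, returnWeight, h.transitionProb_eq_sum, Finset.mul_sum, Finset.sum_mul]
  rw [Finset.sum_comm]
  exact Finset.sum_congr rfl fun k _ => Finset.sum_congr rfl fun i _ => by ring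

theorem sum_returnWeight (h : IsEigenbasis Q p T D) : ∑ k, returnWeight p T k = ∑ i, p i := by
  simpa [returnProb, transitionProb_zero] using (h.returnProb_eq_sum 0).symm

theorem returnWeight_pos (h : IsEigenbasis Q p T D) (hpos : ∀ i, 0 < p i) (k : S) :
    0 < returnWeight p T k := by
  obtain ⟨i, hi⟩ : ∃ i, T i k ≠ 0 := by
    by_contra! hzero
    simpa [hzero] using h.sum_mul_mul k k
  have := hpos i
  exact Finset.sum_pos' (fun i _ => by positivity) ⟨i, Finset.mem_univ i, by positivity⟩

theorem eigenvalue_eq_neg_dirichletForm (h : IsEigenbasis Q p T D) (hQ : IsGenerator Q)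
    (hp : IsStationary Q p) (k : S) : D k = -dirichletForm Q p fun i => T i k := by
  have heigen (i : S) : (Q *ᵥ fun i => T i k) i = D k * T i k := by
    have hik := congrFun₂ h.eigen i k
    rwa [mul_diagonal, mul_apply, mul_comm] at hik
  rw [← hQ.sum_mul_mulVec hp]
  calc D k = D k * ∑ i, p i * T i k * T i k := by rw [h.sum_mul_mul, one_apply_eq, mul_one]
    _ = ∑ i, p i * T i k * (Q *ᵥ fun i => T i k) i := by
      simp only [Finset.mul_sum, heigen]
      exact Finset.sum_congr rfl fun i _ => by ring

theorem eigenvalue_nonpos (h : IsEigenbasis Q p T D) (hQ : IsGenerator Q) (hp : IsStationary Q p)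
    (k : S) : D k ≤ 0 := by
  rw [h.eigenvalue_eq_neg_dirichletForm hQ hp]
  exact neg_nonpos.2 (hQ.dirichletForm_nonneg hp.nonneg _)

variable (h : IsEigenbasis Q p T D) (hQ : IsGenerator Q) (hirr : IsIrreducible Q)
  (hp : IsStationary Q p) (hpos : ∀ i, 0 < p i)
include h hQ hirr hp hpos

theorem eq_of_eigenvalue_eq_zero (hk : D k = 0) (i j : S) : T i k = T j k := by
  refine hQ.eq_of_dirichletForm_eq_zero hirr hpos (f := fun i => T i k) ?_ i j
  rw [← neg_eq_zero, ← h.eigenvalue_eq_neg_dirichletForm hQ hp, hk]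

theorem mul_eq_one_apply (hk : D k = 0) (hl : D l = 0) (i j : S) :
    T i k * T j l = (1 : Matrix S S ℝ) k l := by
  have hconst {k : S} (hk : D k = 0) := h.eq_of_eigenvalue_eq_zero hQ hirr hp hpos hk
  calc T i k * T j l = (∑ m, p m) * (T i k * T j l) := by rw [hp.sum_eq_one, one_mul]
    _ = ∑ m, p m * T m k * T m l := by
      rw [Finset.sum_mul]
      exact Finset.sum_congr rfl fun m _ => by rw [hconst hk i m, hconst hl j m]; ring
    _ = (1 : Matrix S S ℝ) k l := h.sum_mul_mul k l

theorem eigenvalue_neg (hk : D k = 0) (hlk : l ≠ k) : D l < 0 := by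
  refine (h.eigenvalue_nonpos hQ hp l).lt_of_ne fun hl => ?_
  have hkk := h.mul_eq_one_apply hQ hirr hp hpos hk hk k k
  have hll := h.mul_eq_one_apply hQ hirr hp hpos hl hl k k
  have hlk' := h.mul_eq_one_apply hQ hirr hp hpos hl hk k k
  rw [one_apply_eq] at hkk hll
  rw [one_apply_ne hlk, mul_eq_zero] at hlk'
  obtain hzero | hzero := hlk' <;> simp [hzero] at hkk hll

theorem returnWeight_of_eigenvalue_eq_zero (hk : D k = 0) :
    returnWeight p T k = ∑ i, p i ^ 2 := by
  refine Finset.sum_congr rfl fun i _ => ?_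
  rw [sq (T i k), h.mul_eq_one_apply hQ hirr hp hpos hk hk, one_apply_eq, mul_one]

theorem transitionProb_sub_eq_sum (hk : D k = 0) (t : ℝ≥0) (i j : S) :
    transitionProb Q t i j - p j =
      ∑ l ∈ Finset.univ.erase k, p j * T i l * T j l * Real.exp (D l * t) := by
  rw [h.transitionProb_eq_sum, ← Finset.add_sum_erase _ _ (Finset.mem_univ k), mul_assoc (p j),
    h.mul_eq_one_apply hQ hirr hp hpos hk hk, one_apply_eq, hk]
  simp

end IsEigenbasis

/-- Exponential ergodicity: the transition probabilities `P_t(i, j)` converge to `p j`, uniformly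
in `i` and `j` and with error at most `C e^{-δt}`. -/
structure IsMixing (Q : Matrix S S ℝ) (p : S → ℝ) (C δ : ℝ) : Prop where
  rate_pos : 0 < δ
  abs_sub_le : ∀ (t : ℝ≥0) (i j : S), |transitionProb Q t i j - p j| ≤ C * Real.exp (-δ * t)

theorem IsEigenbasis.exists_isMixing {T : Matrix S S ℝ} {D : S → ℝ} {k : S}
    (h : IsEigenbasis Q p T D) (hQ : IsGenerator Q) (hirr : IsIrreducible Q)
    (hp : IsStationary Q p) (hpos : ∀ i, 0 < p i) (hk : D k = 0) : ∃ C δ, IsMixing Q p C δ := by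
  obtain ⟨δ, hgap, hδ⟩ : ∃ δ : ℝ, (∀ l, l ≠ k → D l ≤ -δ) ∧ 0 < δ := by
    have hgap : ∀ᶠ δ : ℝ in 𝓝[>] 0, ∀ l, l ≠ k → D l ≤ -δ := by
      refine eventually_all.2 fun l => ?_
      obtain rfl | hlk := eq_or_ne l k
      · simp
      · have hpos := neg_pos.2 (h.eigenvalue_neg hQ hirr hp hpos hk hlk)
        filter_upwards [Ioo_mem_nhdsGT hpos] with δ hδ _
        linarith [hδ.2]
    exact (hgap.and self_mem_nhdsWithin).exists
  obtain ⟨C, hC⟩ := Finite.bddAbove_range fun x : S × S =>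
    ∑ l ∈ Finset.univ.erase k, |p x.2 * T x.1 l * T x.2 l|
  refine ⟨C, δ, hδ, fun t i j => ?_⟩
  rw [h.transitionProb_sub_eq_sum hQ hirr hp hpos hk]
  calc |∑ l ∈ Finset.univ.erase k, p j * T i l * T j l * Real.exp (D l * t)|
      ≤ ∑ l ∈ Finset.univ.erase k, |p j * T i l * T j l| * Real.exp (-δ * t) := by
        refine (Finset.abs_sum_le_sum_abs _ _).trans (Finset.sum_le_sum fun l hl => ?_)
        rw [abs_mul, Real.abs_exp]
        gcongr
        exact hgap l (Finset.ne_of_mem_erase hl)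
    _ ≤ C * Real.exp (-δ * t) := by
        rw [← Finset.sum_mul]
        gcongr
        exact hC ⟨(i, j), rfl⟩

namespace IsMixing

variable {C δ : ℝ}

theorem nonneg [Nonempty S] (h : IsMixing Q p C δ) : 0 ≤ C := by
  inhabit S
  simpa using (abs_nonneg _).trans (h.abs_sub_le 0 (default : S) (default : S))

theorem abs_transitionProb_le (h : IsMixing Q p C δ) (hp : IsStationary Q p) (t : ℝ≥0) (i j : S) :
    |transitionProb Q t i j| ≤ C + 1 := by
  have : Nonempty S := ⟨i⟩
  calc |transitionProb Q t i j| ≤ |transitionProb Q t i j - p j| + |p j| := by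
        simpa using abs_add_le (transitionProb Q t i j - p j) (p j)
    _ ≤ C * 1 + 1 := by
        refine add_le_add ((h.abs_sub_le t i j).trans ?_) ?_
        · refine mul_le_mul_of_nonneg_left (Real.exp_le_one_iff.2 ?_) h.nonneg
          nlinarith [h.rate_pos, t.2]
        · rw [abs_of_nonneg (hp.nonneg j)]
          exact hp.le_one j
    _ = C + 1 := by rw [mul_one]

theorem abs_returnProb_le (h : IsMixing Q p C δ) (hp : IsStationary Q p) (t : ℝ≥0) :
    |returnProb Q p t| ≤ C + 1 := by
  calc |returnProb Q p t| ≤ ∑ j, p j * (C + 1) := by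
        refine (Finset.abs_sum_le_sum_abs _ _).trans (Finset.sum_le_sum fun j _ => ?_)
        rw [abs_mul, abs_of_nonneg (hp.nonneg j)]
        exact mul_le_mul_of_nonneg_left (h.abs_transitionProb_le hp t j j) (hp.nonneg j)
    _ = C + 1 := by rw [← Finset.sum_mul, hp.sum_eq_one, one_mul]

end IsMixing

theorem continuous_returnProb (Q : Matrix S S ℝ) (p : S → ℝ) : Continuous (returnProb Q p) :=
  continuous_finsetSum _ fun j _ => continuous_const.mul (continuous_transitionProb Q j j)

end Spectral

section FreshnessCurve

variable {ι : Type*} [Fintype ι] {a b d : ι → ℝ}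

/-- The mean freshness as a function of the sampling rate `x`, with coefficients `a` and decay
rates `d`. -/
noncomputable def freshnessCurve (a d : ι → ℝ) (x : ℝ) : ℝ := 1 - ∑ j, a j / (x + d j)

theorem freshnessCurve_mul_eq (hd : ∀ j, 0 < d j) {c : ℝ} (hc : c + ∑ j, b j = 1) {x : ℝ}
    (hx : 0 < x) :
    freshnessCurve (fun j => b j * d j) d x = c + x * ∑ j, b j / (x + d j) := by
  have hterm (j : ι) : x * (b j / (x + d j)) = b j - b j * d j / (x + d j) := by
    have := hd j
    field_simp
    ring
  simp only [freshnessCurve, Finset.mul_sum, hterm, Finset.sum_sub_distrib]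
  rw [← hc]
  ring

theorem strictMonoOn_freshnessCurve [Nonempty ι] (ha : ∀ j, 0 < a j) (hd : ∀ j, 0 < d j) :
    StrictMonoOn (freshnessCurve a d) (Set.Ioi 0) := fun _ hx _ _ hxy =>
  sub_lt_sub_left (Finset.sum_lt_sum_of_nonempty Finset.univ_nonempty fun j _ =>
    div_lt_div_of_pos_left (ha j) (add_pos hx (hd j)) (add_lt_add_left hxy (d j))) 1

theorem strictConvexOn_div_add {a d : ℝ} (ha : 0 < a) (hd : 0 < d) :
    StrictConvexOn ℝ (Set.Ioi 0) fun x => a / (x + d) := by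
  have hinv : StrictConvexOn ℝ (Set.Ioi 0) fun x : ℝ => x ^ (-1 : ℤ) :=
    strictConvexOn_zpow (by norm_num) (by norm_num)
  have hshift := (hinv.translate_left d).subset (fun x (hx : 0 < x) => add_pos hd hx)
    (convex_Ioi 0)
  refine ⟨convex_Ioi 0, fun x hx y hy hxy u v hu hv huv => ?_⟩
  have hlt := mul_lt_mul_of_pos_left (hshift.2 hx hy hxy hu hv huv) ha
  simp only [Function.comp_apply, _root_.zpow_neg_one, smul_eq_mul, div_eq_mul_inv] at hlt ⊢
  linarith

theorem strictConcaveOn_freshnessCurve [Nonempty ι] (ha : ∀ j, 0 < a j) (hd : ∀ j, 0 < d j) :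
    StrictConcaveOn ℝ (Set.Ioi 0) (freshnessCurve a d) := by
  refine ⟨convex_Ioi 0, fun x hx y hy hxy u v hu hv huv => ?_⟩
  have hlt := Finset.sum_lt_sum_of_nonempty Finset.univ_nonempty fun j (_ : j ∈ Finset.univ) =>
    (strictConvexOn_div_add (ha j) (hd j)).2 hx hy hxy hu hv huv
  simp only [Finset.sum_add_distrib, smul_eq_mul, ← Finset.mul_sum] at hlt
  simp only [freshnessCurve, smul_eq_mul]
  linarith

theorem contDiffOn_freshnessCurve (hd : ∀ j, 0 < d j) :
    ContDiffOn ℝ 1 (freshnessCurve a d) (Set.Ioi 0) :=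
  contDiffOn_const.sub <| ContDiffOn.sum fun j _ => contDiffOn_const.div
    (contDiffOn_id.add contDiffOn_const) fun _ hx => (add_pos hx (hd j)).ne'

theorem tendsto_freshnessCurve_mul (hd : ∀ j, 0 < d j) {c : ℝ} (hc : c + ∑ j, b j = 1) :
    Tendsto (freshnessCurve (fun j => b j * d j) d) (𝓝[>] 0) (𝓝 c) := by
  have hcont : ContinuousAt (freshnessCurve (fun j => b j * d j) d) 0 := by
    refine continuousAt_const.sub (tendsto_finsetSum _ fun j _ => ?_)
    exact continuousAt_const.div (continuousAt_id.add continuousAt_const) (by simp [(hd j).ne'])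
  have hzero : freshnessCurve (fun j => b j * d j) d 0 = c := by
    simp only [freshnessCurve, zero_add, mul_div_cancel_right₀ _ (hd _).ne', ← hc,
      add_sub_cancel_right]
  exact hzero ▸ hcont.tendsto.mono_left nhdsWithin_le_nhds

end FreshnessCurve

section ExponentialAge

theorem integral_expMeasure {r : ℝ} (hr : 0 < r) (f : ℝ → ℝ) :
    ∫ x, f x ∂expMeasure r = ∫ x in Set.Ioi 0, r * Real.exp (-r * x) * f x := by
  rw [expMeasure, gammaMeasure, integral_withDensity_eq_integral_toReal_smul
    (by exact (measurable_exponentialPDFReal r).ennreal_ofReal) (by simp [gammaPDF]),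
    ← integral_Ici_eq_integral_Ioi, ← integral_indicator measurableSet_Ici]
  refine integral_congr_ae (Eventually.of_forall fun x => ?_)
  obtain hx | hx := lt_or_ge x 0
  · simp [gammaPDF_of_neg hx, hx]
  · have hpos : 0 ≤ r * Real.exp (-(r * x)) := by positivity
    have hpdf : gammaPDF 1 r x = ENNReal.ofReal (r * Real.exp (-(r * x))) :=
      exponentialPDF_of_nonneg hx
    simp [hpdf, hx, ENNReal.toReal_ofReal hpos]

theorem integral_exp_mul_expMeasure {r D : ℝ} (hr : 0 < r) (hD : D ≤ 0) :
    ∫ x, Real.exp (D * x.toNNReal) ∂expMeasure r = r / (r - D) := by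
  have hexp : Set.EqOn (fun x : ℝ => r * Real.exp (-r * x) * Real.exp (D * x.toNNReal))
      (fun x => r * Real.exp ((D - r) * x)) (Set.Ioi 0) := fun x hx => by
    simp only [Real.coe_toNNReal x (le_of_lt hx), mul_assoc, ← Real.exp_add]
    ring_nf
  rw [integral_expMeasure hr, setIntegral_congr_fun measurableSet_Ioi hexp, integral_const_mul,
    integral_exp_mul_Ioi (by linarith), mul_zero, Real.exp_zero, neg_div, ← div_neg, neg_sub,
    mul_one_div]

theorem integrable_exp_mul_expMeasure {r D : ℝ} (hr : 0 < r) (hD : D ≤ 0) :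
    Integrable (fun x : ℝ => Real.exp (D * x.toNNReal)) (expMeasure r) := by
  have := isProbabilityMeasure_expMeasure hr
  refine Integrable.of_bound (by fun_prop) 1 (Eventually.of_forall fun x => ?_)
  rw [Real.norm_of_nonneg (Real.exp_pos _).le, Real.exp_le_one_iff]
  exact mul_nonpos_of_nonpos_of_nonneg hD NNReal.zero_le_coe

theorem measureReal_expMeasure_Iic {r x : ℝ} (hr : 0 < r) (hx : 0 ≤ x) :
    (expMeasure r).real (Set.Iic x) = 1 - Real.exp (-(r * x)) := by
  have := isProbabilityMeasure_expMeasure hr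
  rw [← cdf_eq_real, cdf_expMeasure_eq hr, if_pos hx]

variable {S : Type*} [Fintype S] [DecidableEq S] {Q : Matrix S S ℝ} {p : S → ℝ}

/-- The probability that the stationary chain is in the same state as an independent exponential
time of rate `r` earlier: in the long run, this is the law of the age of the latest sample. -/
noncomputable def meanFreshness (Q : Matrix S S ℝ) (p : S → ℝ) (r : ℝ) : ℝ :=
  ∫ v, returnProb Q p v.toNNReal ∂expMeasure r

namespace IsEigenbasis

theorem meanFreshness_eq_sum {T : Matrix S S ℝ} {D : S → ℝ} (h : IsEigenbasis Q p T D)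
    (hD : ∀ k, D k ≤ 0) {r : ℝ} (hr : 0 < r) :
    meanFreshness Q p r = ∑ k, returnWeight p T k * (r / (r - D k)) := by
  simp only [meanFreshness, h.returnProb_eq_sum]
  rw [integral_finsetSum _ fun k _ => (integrable_exp_mul_expMeasure hr (hD k)).const_mul _]
  simp only [integral_const_mul, integral_exp_mul_expMeasure hr (hD _)]

variable {n : ℕ} {Q T : Matrix (Fin (n + 1)) (Fin (n + 1)) ℝ} {p : Fin (n + 1) → ℝ} {d : Fin n → ℝ}
  (h : IsEigenbasis Q p T (Fin.snoc (α := fun _ => ℝ) (fun j => -d j) 0)) (hQ : IsGenerator Q)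
  (hirr : IsIrreducible Q) (hp : IsStationary Q p) (hpos : ∀ i, 0 < p i)
include h hQ hirr hp hpos

theorem decayRate_pos (j : Fin n) : 0 < d j := by
  simpa using h.eigenvalue_neg hQ hirr hp hpos (k := Fin.last n) (l := j.castSucc)
    (by simp) (Fin.castSucc_lt_last j).ne

theorem sum_sq_add_sum_returnWeight :
    ∑ i, p i ^ 2 + ∑ j : Fin n, returnWeight p T j.castSucc = 1 := by
  rw [← hp.sum_eq_one, ← h.sum_returnWeight, Fin.sum_univ_castSucc (returnWeight p T), add_comm,
    h.returnWeight_of_eigenvalue_eq_zero hQ hirr hp hpos (by simp)]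

theorem meanFreshness_eq_freshnessCurve {r : ℝ} (hr : 0 < r) :
    meanFreshness Q p r = freshnessCurve (fun j => returnWeight p T j.castSucc * d j) d r := by
  rw [freshnessCurve_mul_eq (h.decayRate_pos hQ hirr hp hpos)
    (h.sum_sq_add_sum_returnWeight hQ hirr hp hpos) hr,
    h.meanFreshness_eq_sum (h.eigenvalue_nonpos hQ hp) hr, Fin.sum_univ_castSucc, add_comm,
    h.returnWeight_of_eigenvalue_eq_zero hQ hirr hp hpos (by simp), Finset.mul_sum]
  simp only [Fin.snoc_last, Fin.snoc_castSucc, sub_zero, sub_neg_eq_add, div_self hr.ne', mul_one,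
    mul_div_left_comm r]

end IsEigenbasis

end ExponentialAge

section JointMeasurability

variable {Ω : Type*} [MeasurableSpace Ω] {S : Type*} [MeasurableSpace S]
  [MeasurableSingletonClass S] [Countable S]

/-- The right end of the cell of the half-open grid of mesh `1 / (m + 1)` that contains `t`. -/
noncomputable def gridCeil (m : ℕ) (t : ℝ≥0) : ℝ≥0 := (⌊t * (m + 1 : ℕ)⌋₊ + 1 : ℕ) / (m + 1 : ℕ)

theorem tendsto_gridCeil (t : ℝ≥0) : Tendsto (fun m => gridCeil m t) atTop (𝓝[>] t) := by
  have hlt : ∀ m, t < gridCeil m t := fun m => by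
    rw [gridCeil, lt_div_iff₀ (by positivity)]
    exact_mod_cast Nat.lt_floor_add_one (t * (m + 1 : ℕ))
  have hle : ∀ m, gridCeil m t ≤ t + 1 / (m + 1 : ℕ) := fun m => by
    have hm : (0 : ℝ≥0) < (m + 1 : ℕ) := by positivity
    rw [gridCeil, div_le_iff₀ hm, add_mul, one_div, inv_mul_cancel₀ hm.ne', Nat.cast_add,
      Nat.cast_one]
    exact add_le_add (Nat.floor_le zero_le) le_rfl
  have hmesh : Tendsto (fun m : ℕ => t + 1 / ((m + 1 : ℕ) : ℝ≥0)) atTop (𝓝 t) := by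
    simpa using ((tendsto_const_div_atTop_nhds_zero_nat (1 : ℝ≥0)).comp
      (tendsto_add_atTop_nat 1)).const_add t
  exact tendsto_nhdsWithin_iff.2 ⟨tendsto_of_tendsto_of_tendsto_of_le_of_le tendsto_const_nhds
    hmesh (fun m => (hlt m).le) hle, Eventually.of_forall hlt⟩

theorem measurable_uncurry_of_eventually_eq {F : ℝ≥0 → Ω → S} (hF : ∀ t, Measurable (F t))
    (hr : ∀ ω t, ∀ᶠ s in 𝓝[>] t, F s ω = F t ω) : Measurable (Function.uncurry F) := by
  have hgrid : ∀ m, Measurable fun x : ℝ≥0 × Ω => F (gridCeil m x.1) x.2 := fun m => by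
    have hpt : Measurable fun y : ℕ × Ω => F ((y.1 + 1 : ℕ) / (m + 1 : ℕ)) y.2 :=
      measurable_from_prod_countable_right fun k => hF ((k + 1 : ℕ) / (m + 1 : ℕ))
    have hcell : Measurable fun x : ℝ≥0 × Ω => (⌊x.1 * (m + 1 : ℕ)⌋₊, x.2) :=
      (Nat.measurable_floor.comp (measurable_fst.mul_const _)).prodMk measurable_snd
    exact hpt.comp hcell
  refine measurable_to_countable' fun i => measurableSet_of_tendsto_indicator (L := atTop)
    (fun m => hgrid m (measurableSet_singleton i)) fun x => ?_
  filter_upwards [(tendsto_gridCeil x.1).eventually (hr x.2 x.1)] with m hm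
  simp only [Set.mem_preimage, Set.mem_singleton_iff, hm, Function.uncurry]

end JointMeasurability

section ExponentialLaw

theorem measureReal_expMeasure_le_toNNReal {r : ℝ} (hr : 0 < r) (w : ℝ≥0) :
    (expMeasure r).real {x | w ≤ x.toNNReal} = Real.exp (-(r * w)) := by
  have := isProbabilityMeasure_expMeasure hr
  obtain rfl | hw := eq_zero_or_pos w
  · simp
  · have hset : {x : ℝ | w ≤ x.toNNReal} = (Set.Iio (w : ℝ))ᶜ := by
      ext x
      simp [Real.le_toNNReal_iff_coe_le' hw]
    have hatom : expMeasure r {(w : ℝ)} = 0 :=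
      withDensity_absolutelyContinuous _ _ (measure_singleton _)
    rw [hset, probReal_compl_eq_one_sub measurableSet_Iio, measureReal_congr (Iio_ae_eq_Iic' hatom),
      measureReal_expMeasure_Iic hr w.coe_nonneg, sub_sub_cancel]

end ExponentialLaw

section LatestSample

/-- The latest sampling time in `[u, t]`, replaced by `u` if there is none: a version of
`latestSamplingTime` that depends on the sampling process in `[u, t]` only. -/
noncomputable def lastSampleSince {Ω : Type*} (N : ℝ≥0 → Ω → ℕ) (u t : ℝ≥0) (ω : Ω) : ℝ≥0 :=
  max u (latestSamplingTime N t ω)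

variable {Ω : Type*} {N : ℝ≥0 → Ω → ℕ} {s t u : ℝ≥0} {ω : Ω}

theorem le_lastSampleSince : u ≤ lastSampleSince N u t ω := le_max_left _ _

theorem latestSamplingTime_le : latestSamplingTime N t ω ≤ t := csSup_le' fun _ hs => hs.1

theorem lastSampleSince_le (hut : u ≤ t) : lastSampleSince N u t ω ≤ t :=
  max_le hut latestSamplingTime_le

variable [MeasurableSpace Ω] {P : Measure Ω} {r : ℝ≥0}

namespace IsPoissonProcess

theorem exists_isSamplingTime_of_lt (hN : IsPoissonProcess P r N) (hst : N s ω < N t ω) :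
    ∃ q, s < q ∧ q ≤ t ∧ IsSamplingTime N ω q := by
  have hne : {x | N x ω = N t ω}.Nonempty := ⟨t, rfl⟩
  set q := sInf {x | N x ω = N t ω}
  have hqt : q ≤ t := csInf_le' rfl
  have hlt : ∀ x, q < x → x ≤ t → N x ω = N t ω := fun x hx hxt => by
    obtain ⟨y, hy, hyx⟩ := exists_lt_of_csInf_lt hne hx
    exact le_antisymm (hN.mono ω hxt) (hy.symm.le.trans (hN.mono ω hyx.le))
  have hNq : N q ω = N t ω := by
    obtain h | h := hqt.eq_or_lt
    · rw [h]
    · have hmem : ∀ᶠ x in 𝓝[>] q, x ∈ Set.Ioc q t := Ioc_mem_nhdsGT h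
      obtain ⟨x, hx, hxq⟩ := (hmem.and (hN.right_continuous ω q)).exists
      rw [← hxq, hlt x hx.1 hx.2]
  have hsq : s < q := (hN.mono ω).reflect_lt (hst.trans_eq hNq.symm)
  refine ⟨q, hsq, hqt, zero_le.trans_lt hsq, fun x hx => ?_⟩
  exact ((hN.mono ω hx.le).lt_of_ne fun h => notMem_of_lt_csInf' hx (h.trans hNq))

theorem latestSamplingTime_le_iff (hN : IsPoissonProcess P r N) (hst : s ≤ t) :
    latestSamplingTime N t ω ≤ s ↔ N s ω = N t ω := by
  refine ⟨fun h => (hN.mono ω hst).eq_of_not_lt fun hlt => ?_, fun h => ?_⟩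
  · obtain ⟨q, hsq, hqt, hq⟩ := hN.exists_isSamplingTime_of_lt hlt
    have hbdd : BddAbove {x | x ≤ t ∧ IsSamplingTime N ω x} := ⟨t, fun _ hx => hx.1⟩
    exact (hsq.trans_le (le_csSup hbdd ⟨hqt, hq⟩)).not_ge h
  · refine csSup_le' fun q hq => ?_
    exact not_lt.1 fun hsq => ((hq.2.2 s hsq).trans_le (hN.mono ω hq.1)).ne h

theorem lastSampleSince_le_iff (hN : IsPoissonProcess P r N) {x : ℝ≥0} :
    lastSampleSince N u t ω ≤ x ↔ u ≤ x ∧ N (min x t) ω = N t ω := by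
  rw [lastSampleSince, max_le_iff, ← hN.latestSamplingTime_le_iff (min_le_right x t),
    le_min_iff, and_iff_left latestSamplingTime_le]

theorem lastSampleSince_of_lt (hN : IsPoissonProcess P r N) (h : N u ω < N t ω) :
    lastSampleSince N u t ω = latestSamplingTime N t ω := by
  have hut : u ≤ t := ((hN.mono ω).reflect_lt h).le
  refine max_eq_right (le_of_not_ge fun hle => h.ne ?_)
  exact (hN.latestSamplingTime_le_iff hut).1 hle

theorem exists_isSamplingTime_iff (hN : IsPoissonProcess P r N) :
    (∃ s ≤ t, IsSamplingTime N ω s) ↔ 0 < N t ω := by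
  refine ⟨fun ⟨s, hst, hs, hjump⟩ => ?_, fun h => ?_⟩
  · exact zero_le.trans_lt ((hjump 0 hs).trans_le (hN.mono ω hst))
  · obtain ⟨q, -, hqt, hq⟩ := hN.exists_isSamplingTime_of_lt ((hN.zero ω).trans_lt h)
    exact ⟨q, hqt, hq⟩

theorem measurable_uncurry (hN : IsPoissonProcess P r N) : Measurable (Function.uncurry N) :=
  measurable_uncurry_of_eventually_eq hN.measurable hN.right_continuous

theorem measurable_uncurry_latestSamplingTime (hN : IsPoissonProcess P r N) :
    Measurable (Function.uncurry (latestSamplingTime N)) := by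
  refine measurable_of_Iic fun x => ?_
  have hset : Function.uncurry (latestSamplingTime N) ⁻¹' Set.Iic x =
      {z | N (min x z.1) z.2 = N z.1 z.2} := by
    ext z
    rw [Set.mem_preimage, Set.mem_Iic, Set.mem_ofPred_eq,
      ← hN.latestSamplingTime_le_iff (min_le_right x z.1), le_min_iff,
      and_iff_left latestSamplingTime_le]
    rfl
  rw [hset]
  exact measurableSet_eq_fun (hN.measurable_uncurry.comp
    ((measurable_const.min measurable_fst).prodMk measurable_snd)) hN.measurable_uncurry

theorem measurable_lastSampleSince {Ω : Type*} {m : MeasurableSpace Ω} [MeasurableSpace Ω]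
    {P : Measure Ω} {N : ℝ≥0 → Ω → ℕ} (hN : IsPoissonProcess P r N)
    (hm : ∀ t, Measurable[m] (N t)) (u t : ℝ≥0) : Measurable[m] (lastSampleSince N u t) := by
  refine measurable_of_Iic fun x => ?_
  have hset : lastSampleSince N u t ⁻¹' Set.Iic x = {ω | u ≤ x ∧ N (min x t) ω = N t ω} :=
    Set.ext fun ω => hN.lastSampleSince_le_iff
  rw [hset, Set.ofPred_and]
  exact (MeasurableSet.const _).inter (measurableSet_eq_fun (hm _) (hm _))

end IsPoissonProcess

end LatestSample

theorem indepFun_of_indepSet_Iic {Ω α β : Type*} [MeasurableSpace Ω] {P : Measure Ω}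
    [IsZeroOrProbabilityMeasure P]
    [TopologicalSpace α] [MeasurableSpace α] [BorelSpace α] [LinearOrder α] [OrderTopology α]
    [SecondCountableTopology α]
    [TopologicalSpace β] [MeasurableSpace β] [BorelSpace β] [LinearOrder β] [OrderTopology β]
    [SecondCountableTopology β] {Y : Ω → α} {Z : Ω → β} (hY : Measurable Y) (hZ : Measurable Z)
    (h : ∀ y z, IndepSet (Y ⁻¹' Set.Iic y) (Z ⁻¹' Set.Iic z) P) : IndepFun Y Z P := by
  rw [IndepFun_iff_Indep]
  refine IndepSets.indep hY.comap_le hZ.comap_le (isPiSystem_Iic.comap Y) (isPiSystem_Iic.comap Z)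
    ?_ ?_ ?_
  · rw [‹BorelSpace α›.measurable_eq, borel_eq_generateFrom_Iic, MeasurableSpace.comap_generateFrom]
    rfl
  · rw [‹BorelSpace β›.measurable_eq, borel_eq_generateFrom_Iic, MeasurableSpace.comap_generateFrom]
    rfl
  · rw [IndepSets_iff]
    rintro _ _ ⟨_, ⟨y, rfl⟩, rfl⟩ ⟨_, ⟨z, rfl⟩, rfl⟩
    exact (indepSet_iff_measure_inter_eq_mul (hY measurableSet_Iic) (hZ measurableSet_Iic) P).1
      (h y z)

section LatestSampleLaw

variable {Ω : Type*} [MeasurableSpace Ω] {P : Measure Ω} {r : ℝ≥0} {N : ℝ≥0 → Ω → ℕ}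
  {s t u : ℝ≥0}

namespace IsPoissonProcess

theorem setOf_eval_eq (hN : IsPoissonProcess P r N) (hst : s ≤ t) :
    {ω | N s ω = N t ω} = (fun ω => N t ω - N s ω) ⁻¹' {0} := by
  ext ω
  rw [Set.mem_ofPred_eq, Set.mem_preimage, Set.mem_singleton_iff, tsub_eq_zero_iff_le]
  exact ⟨Eq.ge, (hN.mono ω hst).antisymm⟩

theorem measureReal_eval_eq (hN : IsPoissonProcess P r N) (hst : s ≤ t) :
    P.real {ω | N s ω = N t ω} = Real.exp (-(r * (t - s))) := by
  rw [hN.setOf_eval_eq hst]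
  have hlaw := hN.law_increment s t hst
  rw [← map_measureReal_apply_of_aemeasurable hlaw.aemeasurable (measurableSet_singleton 0),
    hlaw.map_eq, poissonMeasure_real_singleton]
  simp [NNReal.coe_sub hst]

theorem measureReal_lastSampleSince_le (hN : IsPoissonProcess P r N) {x : ℝ≥0} (hux : u ≤ x) :
    P.real (lastSampleSince N u t ⁻¹' Set.Iic x) = Real.exp (-(r * (t - x : ℝ≥0))) := by
  have hset : lastSampleSince N u t ⁻¹' Set.Iic x = {ω | N (min x t) ω = N t ω} := by
    ext ω
    exact hN.lastSampleSince_le_iff.trans (and_iff_right hux)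
  rw [hset, hN.measureReal_eval_eq (min_le_right x t), ← NNReal.coe_sub (min_le_right x t),
    min_comm, tsub_min]

variable [IsProbabilityMeasure P]

theorem indepSet_eval_eq (hN : IsPoissonProcess P r N) {a b : ℝ≥0} (has : a ≤ s) (hsb : s ≤ b)
    (hbt : b ≤ t) : IndepSet {ω | N a ω = N s ω} {ω | N b ω = N t ω} P := by
  have hτ : Monotone ![a, s, b, t] := by
    rw [Fin.monotone_iff_le_succ]
    intro i
    fin_cases i <;> simpa
  have h := (hN.indep_increments 3 _ hτ).indepFun (show (0 : Fin 3) ≠ 2 by decide)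
  rw [hN.setOf_eval_eq has, hN.setOf_eval_eq hbt]
  exact (indepFun_iff_indepSet_preimage ((hN.measurable s).sub (hN.measurable a))
    ((hN.measurable t).sub (hN.measurable b))).1 h _ _ (measurableSet_singleton 0)
    (measurableSet_singleton 0)

theorem indepFun_lastSampleSince (hN : IsPoissonProcess P r N) {v : ℝ≥0}
    (hsu : s ≤ u) (hut : u ≤ t) :
    IndepFun (lastSampleSince N v s) (lastSampleSince N u t) P := by
  refine indepFun_of_indepSet_Iic (hN.measurable_lastSampleSince hN.measurable v s)
    (hN.measurable_lastSampleSince hN.measurable u t) fun y z => ?_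
  simp only [Set.preimage, Set.mem_Iic, hN.lastSampleSince_le_iff]
  by_cases hy : v ≤ y
  · by_cases hz : u ≤ z
    · simpa only [hy, hz, true_and] using hN.indepSet_eval_eq (min_le_right y s)
        (hsu.trans (le_min hz hut)) (min_le_right z t)
    · simpa [hz] using indepSet_empty_right _
  · simpa [hy] using indepSet_empty_left _

theorem identDistrib_lastSampleSince (hN : IsPoissonProcess P r N) (hr : 0 < r) :
    IdentDistrib (lastSampleSince N u t) (fun x : ℝ => max u (t - x.toNNReal)) P
      (expMeasure r) := by
  have := isProbabilityMeasure_expMeasure (NNReal.coe_pos.2 hr)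
  have hmeas := hN.measurable_lastSampleSince hN.measurable u t
  have hmeas' : Measurable fun x : ℝ => max u (t - x.toNNReal) := by fun_prop
  refine ⟨hmeas.aemeasurable, hmeas'.aemeasurable, ?_⟩
  have := Measure.isProbabilityMeasure_map (μ := P) hmeas.aemeasurable
  refine Measure.ext_of_Iic _ _ fun x => ?_
  rw [Measure.map_apply hmeas measurableSet_Iic, Measure.map_apply hmeas' measurableSet_Iic,
    ← measureReal_eq_measureReal_iff]
  by_cases hux : u ≤ x
  · rw [hN.measureReal_lastSampleSince_le hux,
      ← measureReal_expMeasure_le_toNNReal (NNReal.coe_pos.2 hr)]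
    simp [Set.preimage, hux, add_comm]
  · simp [Set.preimage, hux, hN.lastSampleSince_le_iff]

end IsPoissonProcess

end LatestSampleLaw

section MarkovAgreement

theorem measureReal_eq_sum_inter {Ω S : Type*} [MeasurableSpace Ω] [Fintype S] [MeasurableSpace S]
    [MeasurableSingletonClass S] {P : Measure Ω} [IsFiniteMeasure P] {Y : Ω → S}
    (hY : Measurable Y) (A : Set Ω) : P.real A = ∑ i, P.real (Y ⁻¹' {i} ∩ A) := by
  have h := sum_measureReal_preimage_singleton (μ := P.restrict A) Finset.univ (f := Y)
    fun i _ => hY (measurableSet_singleton i)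
  simpa [measureReal_restrict_apply (hY (measurableSet_singleton _))] using h.symm

variable {S : Type*} [Fintype S] [DecidableEq S] {Q : Matrix S S ℝ} {p : S → ℝ} {C δ : ℝ}

theorem IsMixing.abs_sum_transitionProb_sub_returnProb_le (hQ : IsMixing Q p C δ)
    (hp : IsStationary Q p) (u v : ℝ≥0) (i : S) :
    |∑ j, transitionProb Q u i j * transitionProb Q v j j - returnProb Q p v| ≤
      Fintype.card S * C * (C + 1) * Real.exp (-δ * u) := by
  have := Nonempty.intro i
  rw [returnProb, ← Finset.sum_sub_distrib]
  calc |∑ j, (transitionProb Q u i j * transitionProb Q v j j - p j * transitionProb Q v j j)|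
      ≤ ∑ _j : S, C * Real.exp (-δ * u) * (C + 1) := by
        refine (Finset.abs_sum_le_sum_abs _ _).trans (Finset.sum_le_sum fun j _ => ?_)
        rw [← sub_mul, abs_mul]
        exact mul_le_mul (hQ.abs_sub_le u i j) (hQ.abs_transitionProb_le hp v j j) (abs_nonneg _)
          (mul_nonneg hQ.nonneg (Real.exp_pos _).le)
    _ = Fintype.card S * C * (C + 1) * Real.exp (-δ * u) := by
        rw [Finset.sum_const, nsmul_eq_mul, Finset.card_univ]
        ring

/-- The event that the source is in the same state at the times `a` and `b`. -/
def agree {Ω S : Type*} (X : ℝ≥0 → Ω → S) (a b : ℝ≥0) : Set Ω := {ω | X a ω = X b ω}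

variable [MeasurableSpace S] {Ω : Type*} [MeasurableSpace Ω] {P : Measure Ω} {X : ℝ≥0 → Ω → S}
  {a s b t : ℝ≥0}

theorem IsCTMC.measureReal_stays_stays (hX : IsCTMC P Q X) (has : a ≤ s) (hsb : s ≤ b) (hbt : b ≤ t)
    (i j : S) :
    P.real {ω | X a ω = i ∧ X s ω = i ∧ X b ω = j ∧ X t ω = j} =
      P.real {ω | X a ω = i ∧ X s ω = i} *
        (transitionProb Q (b - s) i j * transitionProb Q (t - b) j j) := by
  have hτ : Monotone ![a, s] := by
    rw [Fin.monotone_iff_le_succ]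
    exact Fin.forall_fin_one.2 has
  have hτ' : Monotone ![a, s, b] := by
    rw [Fin.monotone_iff_le_succ]
    exact Fin.forall_fin_two.2 ⟨has, hsb⟩
  have hb := hX.markov 1 _ hτ ![i, i] b hsb j
  have ht := hX.markov 2 _ hτ' ![i, i, j] t hbt j
  simp only [Fin.forall_fin_succ, Fin.last, Matrix.cons_val_zero, Matrix.cons_val_succ,
    IsEmpty.forall_iff, and_true, and_assoc] at hb ht
  rw [← mul_assoc]
  exact ht.trans (congrArg (· * _) hb)

variable [MeasurableSingletonClass S] [IsProbabilityMeasure P]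

namespace IsCTMC

theorem measureReal_agree (hX : IsCTMC P Q X) (a s : ℝ≥0) :
    P.real (agree X a s) = ∑ i, P.real {ω | X a ω = i ∧ X s ω = i} := by
  rw [measureReal_eq_sum_inter (hX.measurable a)]
  refine Finset.sum_congr rfl fun i _ => congrArg P.real ?_
  ext ω
  simp only [agree, Set.mem_inter_iff, Set.mem_preimage, Set.mem_singleton_iff,
    Set.mem_ofPred_eq]
  exact and_congr_right fun h => by rw [h, eq_comm]

theorem measureReal_agree_inter (hX : IsCTMC P Q X) (has : a ≤ s) (hsb : s ≤ b) (hbt : b ≤ t) :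
    P.real (agree X a s ∩ agree X b t) = ∑ i, P.real {ω | X a ω = i ∧ X s ω = i} *
      ∑ j, transitionProb Q (b - s) i j * transitionProb Q (t - b) j j := by
  rw [measureReal_eq_sum_inter (hX.measurable a)]
  refine Finset.sum_congr rfl fun i _ => ?_
  rw [measureReal_eq_sum_inter (hX.measurable b), Finset.mul_sum]
  refine Finset.sum_congr rfl fun j _ => ?_
  rw [← hX.measureReal_stays_stays has hsb hbt]
  congr 1
  ext ω
  simp only [agree, Set.mem_inter_iff, Set.mem_preimage, Set.mem_singleton_iff,
    Set.mem_ofPred_eq]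
  grind

end IsCTMC

theorem IsCTMC.abs_measureReal_agree_inter_sub_le (hX : IsCTMC P Q X) (hQ : IsMixing Q p C δ)
    (hp : IsStationary Q p) [Nonempty S] (has : a ≤ s) (hsb : s ≤ b) (hbt : b ≤ t) :
    |P.real (agree X a s ∩ agree X b t) - P.real (agree X a s) * returnProb Q p (t - b)| ≤
      Fintype.card S * C * (C + 1) * Real.exp (-δ * (b - s)) := by
  have hC := hQ.nonneg
  rw [hX.measureReal_agree_inter has hsb hbt, ← NNReal.coe_sub hsb]
  set ε := Fintype.card S * C * (C + 1) * Real.exp (-δ * (b - s : ℝ≥0))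
  have hε : 0 ≤ ε := by positivity
  calc _ = |∑ i, P.real {ω | X a ω = i ∧ X s ω = i} *
          (∑ j, transitionProb Q (b - s) i j * transitionProb Q (t - b) j j -
            returnProb Q p (t - b))| := by
        rw [hX.measureReal_agree, Finset.sum_mul, ← Finset.sum_sub_distrib]
        simp only [mul_sub]
    _ ≤ ∑ i, P.real {ω | X a ω = i ∧ X s ω = i} * ε := by
        refine (Finset.abs_sum_le_sum_abs _ _).trans (Finset.sum_le_sum fun i _ => ?_)
        rw [abs_mul, abs_of_nonneg measureReal_nonneg]
        exact mul_le_mul_of_nonneg_left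
          (hQ.abs_sum_transitionProb_sub_returnProb_le hp _ _ i) measureReal_nonneg
    _ = P.real (agree X a s) * ε := by rw [← Finset.sum_mul, hX.measureReal_agree]
    _ ≤ ε := mul_le_of_le_one_left hε measureReal_le_one

end MarkovAgreement

section Freezing

theorem measureReal_prodMk_eq_integral {Ω α β : Type*} [MeasurableSpace Ω] [MeasurableSpace α]
    [MeasurableSpace β] {P : Measure Ω} [IsProbabilityMeasure P] {ξ : Ω → α} {η : Ω → β}
    (hξη : IndepFun ξ η P) (hξ : Measurable ξ) (hη : Measurable η) {A : Set (α × β)}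
    (hA : MeasurableSet A) :
    P.real {ω | (ξ ω, η ω) ∈ A} = ∫ ω', P.real {ω | (ξ ω, η ω') ∈ A} ∂P := by
  have hprod := (indepFun_iff_map_prod_eq_prod_map_map hξ.aemeasurable hη.aemeasurable).1 hξη
  have := Measure.isProbabilityMeasure_map (μ := P) hξ.aemeasurable
  have hsec : ∀ y, (P.map ξ) ((fun x => (x, y)) ⁻¹' A) = P {ω | (ξ ω, y) ∈ A} := fun y =>
    Measure.map_apply hξ (measurable_prodMk_right hA)
  have hlint : P {ω | (ξ ω, η ω) ∈ A} = ∫⁻ ω', P {ω | (ξ ω, η ω') ∈ A} ∂P := by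
    rw [← lintegral_map (f := fun y => P {ω | (ξ ω, y) ∈ A}) _ hη]
    · simp only [← hsec]
      rw [← Measure.prod_apply_symm hA, ← hprod, Measure.map_apply (hξ.prodMk hη) hA]
      rfl
    · simp only [← hsec]
      exact measurable_measure_prodMk_right hA
  have hmeas : Measurable fun ω' => P {ω | (ξ ω, η ω') ∈ A} := by
    simp only [← hsec]
    exact (measurable_measure_prodMk_right hA).comp hη
  simp only [measureReal_def]
  rw [hlint, integral_toReal hmeas.aemeasurable (Eventually.of_forall fun _ => measure_lt_top _ _)]

variable {S : Type*} [MeasurableSpace S]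

/-- Right-continuous paths in a discrete state space. Unlike on the space of all paths, evaluation
is jointly measurable in the time and the path. -/
def RightContPath (S : Type*) : Type _ := {x : ℝ≥0 → S // ∀ t, ∀ᶠ s in 𝓝[>] t, x s = x t}

instance : MeasurableSpace (RightContPath S) := Subtype.instMeasurableSpace

theorem RightContPath.measurable_eval [Countable S] [MeasurableSingletonClass S] :
    Measurable fun z : ℝ≥0 × RightContPath S => z.2.1 z.1 :=
  measurable_uncurry_of_eventually_eq (F := fun t (x : RightContPath S) => x.1 t)
    (fun t => (measurable_pi_apply t).comp measurable_subtype_coe) fun x => x.2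

variable [Fintype S] [DecidableEq S] {Ω : Type*} [MeasurableSpace Ω] {P : Measure Ω}
  {Q : Matrix S S ℝ} {r : ℝ≥0} {X : ℝ≥0 → Ω → S} {N : ℝ≥0 → Ω → ℕ} {x₀ : Ω → S}

/-- The path of a Markov chain, as a random element of the space of right-continuous paths. -/
def IsCTMC.path (hX : IsCTMC P Q X) (ω : Ω) : RightContPath S :=
  ⟨fun t => X t ω, hX.right_continuous ω⟩

theorem IsCTMC.measurable_path (hX : IsCTMC P Q X) : Measurable hX.path :=
  (measurable_pi_lambda _ hX.measurable).subtype_mk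

variable [MeasurableSingletonClass S]

theorem IsCTMC.measurable_uncurry (hX : IsCTMC P Q X) : Measurable (Function.uncurry X) :=
  measurable_uncurry_of_eventually_eq hX.measurable hX.right_continuous

variable [IsProbabilityMeasure P]

theorem IsCTMC.measurable_measureReal_agree_inter (hX : IsCTMC P Q X) (s t : ℝ≥0) :
    Measurable fun y : ℝ≥0 × ℝ≥0 => P.real (agree X y.1 s ∩ agree X y.2 t) := by
  have hset : MeasurableSet {z : (ℝ≥0 × ℝ≥0) × Ω |
      X z.1.1 z.2 = X s z.2 ∧ X z.1.2 z.2 = X t z.2} := by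
    refine (measurableSet_eq_fun ?_ ?_).inter (measurableSet_eq_fun ?_ ?_)
    · exact hX.measurable_uncurry.comp (measurable_fst.fst.prodMk measurable_snd)
    · exact (hX.measurable s).comp measurable_snd
    · exact hX.measurable_uncurry.comp (measurable_fst.snd.prodMk measurable_snd)
    · exact (hX.measurable t).comp measurable_snd
  exact (measurable_measure_prodMk_left (ν := P) hset).ennreal_toReal

theorem IsPoissonSampled.measureReal_eval_eq_inter_eval_eq (hS : IsPoissonSampled P Q r X N x₀)
    {Y Z : Ω → ℝ≥0} (hY : Measurable[MeasurableSpace.comap (fun ω t => N t ω) inferInstance] Y)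
    (hZ : Measurable[MeasurableSpace.comap (fun ω t => N t ω) inferInstance] Z) (s t : ℝ≥0) :
    P.real ({ω | X (Y ω) ω = X s ω} ∩ {ω | X (Z ω) ω = X t ω}) =
      ∫ ω, P.real (agree X (Y ω) s ∩ agree X (Z ω) t) ∂P := by
  have hN : Measurable fun ω t => N t ω := measurable_pi_lambda _ hS.poisson.measurable
  have hind : IndepFun hS.chain.path (fun ω => (Y ω, Z ω)) P := by
    rw [IndepFun_iff_Indep]
    refine indep_of_indep_of_le_right ?_ (hY.prodMk hZ).comap_le
    have h := hS.indep
    rw [IndepFun_iff_Indep] at h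
    convert h using 1
    exact MeasurableSpace.comap_comp
  have hA : MeasurableSet {z : RightContPath S × (ℝ≥0 × ℝ≥0) |
      z.1.1 z.2.1 = z.1.1 s ∧ z.1.1 z.2.2 = z.1.1 t} := by
    have heval {f : RightContPath S × (ℝ≥0 × ℝ≥0) → ℝ≥0} (hf : Measurable f) :
        Measurable fun z : RightContPath S × (ℝ≥0 × ℝ≥0) => z.1.1 (f z) :=
      RightContPath.measurable_eval.comp (hf.prodMk measurable_fst)
    exact (measurableSet_eq_fun (heval measurable_snd.fst) (heval measurable_const)).inter
      (measurableSet_eq_fun (heval measurable_snd.snd) (heval measurable_const))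
  exact measureReal_prodMk_eq_integral hind hS.chain.measurable_path
    ((hY.mono hN.comap_le le_rfl).prodMk (hZ.mono hN.comap_le le_rfl)) hA

end Freezing

section FreshEvents

variable {S Ω : Type*} {X : ℝ≥0 → Ω → S} {N : ℝ≥0 → Ω → ℕ} {x₀ : Ω → S} {s t u v : ℝ≥0}

/-- The event that the estimator is fresh at time `t`. -/
def freshEvent (X : ℝ≥0 → Ω → S) (N : ℝ≥0 → Ω → ℕ) (x₀ : Ω → S) (t : ℝ≥0) : Set Ω :=
  {ω | estimator X N x₀ t ω = X t ω}

/-- The event that the source has at time `t` the state of its latest sample since time `u`, where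
an extra sample is taken at time `u`. It depends on the sampling times in `(u, t]` only. -/
def freshSince (X : ℝ≥0 → Ω → S) (N : ℝ≥0 → Ω → ℕ) (u t : ℝ≥0) : Set Ω :=
  {ω | X (lastSampleSince N u t ω) ω = X t ω}

theorem freshSince_self (X : ℝ≥0 → Ω → S) (N : ℝ≥0 → Ω → ℕ) (t : ℝ≥0) :
    freshSince X N t t = Set.univ :=
  Set.eq_univ_of_forall fun ω =>
    congrArg (X · ω) (le_antisymm (lastSampleSince_le le_rfl) le_lastSampleSince)

theorem agree_self (X : ℝ≥0 → Ω → S) (t : ℝ≥0) : agree X t t = Set.univ :=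
  Set.eq_univ_of_forall fun _ => rfl

theorem freshness_eq_indicator [DecidableEq S] (X : ℝ≥0 → Ω → S) (N : ℝ≥0 → Ω → ℕ) (x₀ : Ω → S)
    (t : ℝ≥0) :
    freshness X N x₀ t = (freshEvent X N x₀ t).indicator 1 := by
  classical
  ext ω
  simp only [Set.indicator_apply, freshness, freshEvent, Set.mem_ofPred_eq, Pi.one_apply]

variable [MeasurableSpace Ω] {P : Measure Ω} {r : ℝ≥0}

theorem IsPoissonProcess.symmDiff_freshEvent_subset (hN : IsPoissonProcess P r N) (hut : u ≤ t) :
    symmDiff (freshEvent X N x₀ t) (freshSince X N u t) ⊆ {ω | N u ω = N t ω} := by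
  intro ω hω
  by_contra hne
  have hlt : N u ω < N t ω := lt_of_le_of_ne (hN.mono ω hut) hne
  have hiff : ω ∈ freshEvent X N x₀ t ↔ ω ∈ freshSince X N u t := by
    simp only [freshEvent, freshSince, Set.mem_ofPred_eq, hN.lastSampleSince_of_lt hlt, estimator,
      if_pos (hN.exists_isSamplingTime_iff.2 (zero_le.trans_lt hlt))]
  rw [Set.mem_symmDiff] at hω
  tauto

theorem IsPoissonProcess.measureReal_symmDiff_freshEvent_le [IsProbabilityMeasure P]
    (hN : IsPoissonProcess P r N) (hut : u ≤ t) :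
    P.real (symmDiff (freshEvent X N x₀ t) (freshSince X N u t)) ≤ Real.exp (-(r * (t - u))) :=
  (measureReal_mono (hN.symmDiff_freshEvent_subset hut)).trans_eq (hN.measureReal_eval_eq hut)

variable [Fintype S] [DecidableEq S] [MeasurableSpace S] [MeasurableSingletonClass S]
  {Q : Matrix S S ℝ}

namespace IsPoissonSampled

theorem measurableSet_setOf_mem_freshEvent (hS : IsPoissonSampled P Q r X N x₀) :
    MeasurableSet {z : ℝ≥0 × Ω | z.2 ∈ freshEvent X N x₀ z.1} := by
  have hX := hS.chain.measurable_uncurry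
  have hsampled : MeasurableSet {z : ℝ≥0 × Ω | ∃ s ≤ z.1, IsSamplingTime N z.2 s} := by
    simp only [hS.poisson.exists_isSamplingTime_iff]
    exact measurableSet_lt measurable_const hS.poisson.measurable_uncurry
  refine measurableSet_eq_fun (Measurable.ite hsampled ?_ ?_) hX
  · exact hX.comp (hS.poisson.measurable_uncurry_latestSamplingTime.prodMk measurable_snd)
  · exact hS.measurable_init.comp measurable_snd

theorem measurableSet_freshEvent (hS : IsPoissonSampled P Q r X N x₀) (t : ℝ≥0) :
    MeasurableSet (freshEvent X N x₀ t) :=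
  measurable_prodMk_left hS.measurableSet_setOf_mem_freshEvent

theorem measurable_uncurry_freshness (hS : IsPoissonSampled P Q r X N x₀) :
    Measurable (Function.uncurry (freshness X N x₀)) :=
  Measurable.ite hS.measurableSet_setOf_mem_freshEvent measurable_const measurable_const

theorem measurableSet_freshSince (hS : IsPoissonSampled P Q r X N x₀) (u t : ℝ≥0) :
    MeasurableSet (freshSince X N u t) := by
  have hL := hS.poisson.measurable_lastSampleSince hS.poisson.measurable u t
  exact measurableSet_eq_fun (hS.chain.measurable_uncurry.comp (hL.prodMk measurable_id))
    (hS.chain.measurable t)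

variable [IsProbabilityMeasure P]

theorem abs_measureReal_freshEvent_sub_le (hS : IsPoissonSampled P Q r X N x₀) (hut : u ≤ t) :
    |P.real (freshEvent X N x₀ t) - P.real (freshSince X N u t)| ≤
      Real.exp (-(r * (t - u))) :=
  (abs_measureReal_sub_le_measureReal_symmDiff (hS.measurableSet_freshEvent t).nullMeasurableSet
    (hS.measurableSet_freshSince u t).nullMeasurableSet).trans
      (hS.poisson.measureReal_symmDiff_freshEvent_le hut)

theorem abs_measureReal_freshEvent_inter_sub_le (hS : IsPoissonSampled P Q r X N x₀)
    (hvs : v ≤ s) (hut : u ≤ t) :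
    |P.real (freshEvent X N x₀ s ∩ freshEvent X N x₀ t) -
        P.real (freshSince X N v s ∩ freshSince X N u t)| ≤
      Real.exp (-(r * (s - v))) + Real.exp (-(r * (t - u))) := by
  have hsub : symmDiff (freshEvent X N x₀ s ∩ freshEvent X N x₀ t)
      (freshSince X N v s ∩ freshSince X N u t) ⊆
        symmDiff (freshEvent X N x₀ s) (freshSince X N v s) ∪
          symmDiff (freshEvent X N x₀ t) (freshSince X N u t) := fun ω => by
    simp only [Set.mem_symmDiff, Set.mem_union, Set.mem_inter_iff]
    tauto
  calc _ ≤ P.real (symmDiff (freshEvent X N x₀ s ∩ freshEvent X N x₀ t)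
          (freshSince X N v s ∩ freshSince X N u t)) :=
        abs_measureReal_sub_le_measureReal_symmDiff
          ((hS.measurableSet_freshEvent s).inter
            (hS.measurableSet_freshEvent t)).nullMeasurableSet
          ((hS.measurableSet_freshSince v s).inter
            (hS.measurableSet_freshSince u t)).nullMeasurableSet
    _ ≤ _ := (measureReal_mono hsub).trans (measureReal_union_le _ _)
    _ ≤ _ := add_le_add (hS.poisson.measureReal_symmDiff_freshEvent_le hvs)
        (hS.poisson.measureReal_symmDiff_freshEvent_le hut)

theorem measureReal_freshSince_inter (hS : IsPoissonSampled P Q r X N x₀) (v s u t : ℝ≥0) :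
    P.real (freshSince X N v s ∩ freshSince X N u t) = ∫ ω,
      P.real (agree X (lastSampleSince N v s ω) s ∩ agree X (lastSampleSince N u t ω) t) ∂P := by
  have hN : ∀ t, Measurable[MeasurableSpace.comap (fun ω t => N t ω) inferInstance] (N t) :=
    fun t => (measurable_pi_apply t).comp (comap_measurable fun ω t => N t ω)
  exact hS.measureReal_eval_eq_inter_eval_eq (hS.poisson.measurable_lastSampleSince hN v s)
    (hS.poisson.measurable_lastSampleSince hN u t) s t

theorem measureReal_freshSince (hS : IsPoissonSampled P Q r X N x₀) (u t : ℝ≥0) :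
    P.real (freshSince X N u t) = ∫ ω, P.real (agree X (lastSampleSince N u t ω) t) ∂P := by
  have h := hS.measureReal_freshSince_inter u t t t
  have hself (ω) : lastSampleSince N t t ω = t :=
    le_antisymm (lastSampleSince_le le_rfl) le_lastSampleSince
  simpa only [freshSince_self, hself, agree_self, Set.inter_univ] using h

end IsPoissonSampled

end FreshEvents

section Decorrelation

variable {S : Type*} [Fintype S] [DecidableEq S] {Q : Matrix S S ℝ} {p : S → ℝ} {C δ : ℝ}
  {Ω : Type*} [MeasurableSpace Ω] {P : Measure Ω} [IsProbabilityMeasure P] {r : ℝ≥0}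
  {N : ℝ≥0 → Ω → ℕ} {s t u v : ℝ≥0}

theorem abs_integral_le_mul_measureReal {α : Type*} [MeasurableSpace α] {μ : Measure α}
    [IsFiniteMeasure μ] {f : α → ℝ} {B : ℝ} {A : Set α}
    (hf : ∀ x, |f x| ≤ B) (hzero : ∀ x ∉ A, f x = 0) : |∫ x, f x ∂μ| ≤ B * μ.real A := by
  rw [← setIntegral_eq_integral_of_forall_compl_eq_zero hzero]
  exact norm_setIntegral_le_of_norm_le_const (f := f) (measure_lt_top _ _) fun x _ => hf x

theorem integrable_returnProb_comp {α : Type*} [MeasurableSpace α] {μ : Measure α}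
    [IsFiniteMeasure μ] (hQ : IsMixing Q p C δ) (hp : IsStationary Q p) {f : α → ℝ≥0}
    (hf : Measurable f) : Integrable (fun x => returnProb Q p (f x)) μ :=
  Integrable.of_bound ((continuous_returnProb Q p).measurable.comp hf).aestronglyMeasurable
    (C + 1) (Eventually.of_forall fun x => hQ.abs_returnProb_le hp (f x))

theorem IsPoissonProcess.abs_integral_returnProb_sub_meanFreshness_le
    (hN : IsPoissonProcess P r N) (hr : 0 < r) (hQ : IsMixing Q p C δ) (hp : IsStationary Q p)
    (hut : u ≤ t) :
    |∫ ω, returnProb Q p (t - lastSampleSince N u t ω) ∂P - meanFreshness Q p r| ≤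
      2 * (C + 1) * Real.exp (-(r * (t - u))) := by
  have hprob := isProbabilityMeasure_expMeasure (NNReal.coe_pos.2 hr)
  have hlaw : ∫ ω, returnProb Q p (t - lastSampleSince N u t ω) ∂P =
      ∫ x, returnProb Q p (t - max u (t - x.toNNReal)) ∂expMeasure r :=
    ((hN.identDistrib_lastSampleSince hr).comp ((continuous_returnProb Q p).measurable.comp
      (measurable_const.sub measurable_id))).integral_eq
  rw [hlaw, meanFreshness, ← integral_sub (integrable_returnProb_comp hQ hp (by fun_prop))
      (integrable_returnProb_comp hQ hp (by fun_prop)),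
    ← NNReal.coe_sub hut, ← measureReal_expMeasure_le_toNNReal (NNReal.coe_pos.2 hr)]
  refine abs_integral_le_mul_measureReal (fun x => ?_) fun x hx => ?_
  · exact (abs_sub _ _).trans
      (by linarith [hQ.abs_returnProb_le hp (t - max u (t - x.toNNReal)),
        hQ.abs_returnProb_le hp x.toNNReal])
  · rw [Set.mem_ofPred_eq, not_le] at hx
    have hux : u ≤ t - x.toNNReal :=
      le_tsub_of_add_le_left (add_le_of_le_tsub_right_of_le hut hx.le)
    rw [max_eq_right hux, tsub_tsub_cancel_of_le (hx.le.trans tsub_le_self), sub_self]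

variable [MeasurableSpace S] [MeasurableSingletonClass S] [Nonempty S] {X : ℝ≥0 → Ω → S}
  {x₀ : Ω → S}

namespace IsPoissonSampled

theorem abs_measureReal_freshSince_inter_sub_le (hS : IsPoissonSampled P Q r X N x₀)
    (hQ : IsMixing Q p C δ) (hp : IsStationary Q p) (hvs : v ≤ s) (hsu : s ≤ u) (hut : u ≤ t) :
    |P.real (freshSince X N v s ∩ freshSince X N u t) - P.real (freshSince X N v s) *
        ∫ ω, returnProb Q p (t - lastSampleSince N u t ω) ∂P| ≤
      Fintype.card S * C * (C + 1) * Real.exp (-δ * (u - s)) := by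
  have hC := hQ.nonneg
  have hL := hS.poisson.measurable_lastSampleSince hS.poisson.measurable
  have hagree (s t : ℝ≥0) := hS.chain.measurable_measureReal_agree_inter s t
  have hρ : Measurable fun z => returnProb Q p (t - z) :=
    (continuous_returnProb Q p).measurable.comp (measurable_const.sub measurable_id)
  have hσ : Measurable fun y => P.real (agree X y s) := by
    simpa only [agree_self, Set.inter_univ, Function.comp_def, id] using
      (hagree s t).comp (measurable_id.prodMk (measurable_const (a := t)))
  have hprod : P.real (freshSince X N v s) *
      ∫ ω, returnProb Q p (t - lastSampleSince N u t ω) ∂P =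
      ∫ ω, P.real (agree X (lastSampleSince N v s ω) s) *
        returnProb Q p (t - lastSampleSince N u t ω) ∂P := by
    rw [hS.measureReal_freshSince]
    exact (((hS.poisson.indepFun_lastSampleSince hsu hut).comp hσ
      hρ).integral_fun_mul_eq_mul_integral (hσ.comp (hL v s)).aestronglyMeasurable
      (hρ.comp (hL u t)).aestronglyMeasurable).symm
  rw [hprod, hS.measureReal_freshSince_inter, ← integral_sub, ← Real.norm_eq_abs]
  · refine (norm_integral_le_of_norm_le_const (Eventually.of_forall fun ω => ?_)).trans_eq
      (by rw [probReal_univ (μ := P), mul_one])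
    refine (hS.chain.abs_measureReal_agree_inter_sub_le hQ hp (lastSampleSince_le hvs)
      (hsu.trans le_lastSampleSince) (lastSampleSince_le hut)).trans ?_
    have hu : (u : ℝ) ≤ lastSampleSince N u t ω := le_lastSampleSince
    exact mul_le_mul_of_nonneg_left (Real.exp_le_exp.2 (by nlinarith [hQ.rate_pos])) (by positivity)
  · exact Integrable.of_bound
      ((hagree s t).comp ((hL v s).prodMk (hL u t))).aestronglyMeasurable 1
      (Eventually.of_forall fun ω => (Real.norm_of_nonneg measureReal_nonneg).trans_le
        measureReal_le_one)
  · exact (integrable_returnProb_comp hQ hp (measurable_const.sub (hL u t))).bdd_mul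
      (hσ.comp (hL v s)).aestronglyMeasurable (c := 1)
      (Eventually.of_forall fun ω => (Real.norm_of_nonneg measureReal_nonneg).trans_le
        measureReal_le_one)

theorem abs_measureReal_freshSince_inter_sub_meanFreshness_le
    (hS : IsPoissonSampled P Q r X N x₀) (hr : 0 < r) (hQ : IsMixing Q p C δ)
    (hp : IsStationary Q p) (hvs : v ≤ s) (hsu : s ≤ u) (hut : u ≤ t) :
    |P.real (freshSince X N v s ∩ freshSince X N u t) -
        P.real (freshSince X N v s) * meanFreshness Q p r| ≤
      Fintype.card S * C * (C + 1) * Real.exp (-δ * (u - s)) +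
        2 * (C + 1) * Real.exp (-(r * (t - u))) := by
  refine (abs_sub_le _ _ _).trans
    (add_le_add (hS.abs_measureReal_freshSince_inter_sub_le hQ hp hvs hsu hut) ?_)
  rw [← mul_sub, abs_mul, abs_of_nonneg measureReal_nonneg]
  exact (mul_le_of_le_one_left (abs_nonneg _) measureReal_le_one).trans
    (hS.poisson.abs_integral_returnProb_sub_meanFreshness_le hr hQ hp hut)

end IsPoissonSampled

end Decorrelation

section TimeAverage

theorem tendsto_inv_mul_of_lipschitzWith {I : ℝ → ℝ} (hI : LipschitzWith 1 I)
    (h : Tendsto (fun k : ℕ => ((k : ℝ) ^ 2)⁻¹ * I ((k : ℝ) ^ 2)) atTop (𝓝 0)) :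
    Tendsto (fun τ : ℝ => τ⁻¹ * I τ) atTop (𝓝 0) := by
  have hfloor : Tendsto (fun τ : ℝ => ⌊√τ⌋₊) atTop atTop :=
    tendsto_nat_floor_atTop.comp Real.tendsto_sqrt_atTop
  have hsqrt : Tendsto (fun τ : ℝ => 2 / √τ) atTop (𝓝 0) :=
    Real.tendsto_sqrt_atTop.const_div_atTop 2
  have hbound := (h.abs.comp hfloor).add hsqrt
  rw [abs_zero, add_zero] at hbound
  refine squeeze_zero_norm' ?_ hbound
  filter_upwards [eventually_ge_atTop 1] with τ hτ
  set k := ((⌊√τ⌋₊ : ℕ) : ℝ)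
  have hτ0 : 0 < √τ := Real.sqrt_pos.2 (one_pos.trans_le hτ)
  have hsq : √τ ^ 2 = τ := Real.sq_sqrt (zero_le_one.trans hτ)
  have hkle : k ≤ √τ := Nat.floor_le hτ0.le
  have hklt : √τ < k + 1 := Nat.lt_floor_add_one _
  have hk1 : 1 ≤ k := Nat.one_le_cast.2 ((Nat.one_le_floor_iff _).2 (Real.one_le_sqrt.2 hτ))
  have hkτ : k ^ 2 ≤ τ := hsq ▸ pow_le_pow_left₀ (by positivity) hkle 2
  have hgap : |I τ - I (k ^ 2)| ≤ 2 * √τ := by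
    have hlip := hI.dist_le_mul τ (k ^ 2)
    rw [Real.dist_eq, Real.dist_eq, abs_of_nonneg (sub_nonneg.2 hkτ), NNReal.coe_one,
      one_mul] at hlip
    nlinarith
  calc ‖τ⁻¹ * I τ‖ = τ⁻¹ * |I τ| := by
        rw [norm_mul, Real.norm_of_nonneg (by positivity), Real.norm_eq_abs]
    _ ≤ τ⁻¹ * |I (k ^ 2)| + τ⁻¹ * (2 * √τ) := by
        rw [← mul_add]
        gcongr
        linarith [abs_sub_abs_le_abs_sub (I τ) (I (k ^ 2))]
    _ ≤ (k ^ 2)⁻¹ * |I (k ^ 2)| + 2 / √τ := by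
        refine add_le_add (by gcongr) (le_of_eq ?_)
        nth_rw 1 [← hsq]
        field_simp
    _ = |(k ^ 2)⁻¹ * I (k ^ 2)| + 2 / √τ := by
        rw [abs_mul, abs_of_pos (a := (k ^ 2)⁻¹) (by positivity)]

theorem lipschitzWith_intervalIntegral {g : ℝ → ℝ} (hg : Measurable g) (hb : ∀ t, |g t| ≤ 1) :
    LipschitzWith 1 fun τ => ∫ t in (0 : ℝ)..τ, g t := by
  have hgi (a b : ℝ) : IntervalIntegrable g volume a b :=
    (intervalIntegrable_const (c := (1 : ℝ))).mono_fun' hg.aestronglyMeasurable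
      (Eventually.of_forall hb)
  refine LipschitzWith.of_dist_le_mul fun x y => ?_
  rw [Real.dist_eq, intervalIntegral.integral_interval_sub_left (hgi _ _) (hgi _ _)]
  exact intervalIntegral.norm_integral_le_of_norm_le_const (f := g) fun t _ => hb t

variable {Ω : Type*} [MeasurableSpace Ω] {P : Measure Ω}

theorem ae_tendsto_zero_of_summable_integral_sq {Z : ℕ → Ω → ℝ} (hZ : ∀ k, MemLp (Z k) 2 P)
    (hsum : Summable fun k => ∫ ω, Z k ω ^ 2 ∂P) :
    ∀ᵐ ω ∂P, Tendsto (fun k => Z k ω) atTop (𝓝 0) := by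
  have hmeas (k : ℕ) : AEMeasurable (fun ω => ENNReal.ofReal (Z k ω ^ 2)) P :=
    ((hZ k).aestronglyMeasurable.aemeasurable.pow_const 2).ennreal_ofReal
  have hfin : ∫⁻ ω, ∑' k, ENNReal.ofReal (Z k ω ^ 2) ∂P ≠ ⊤ := by
    rw [lintegral_tsum hmeas]
    simp only [← ofReal_integral_eq_lintegral_ofReal (hZ _).integrable_sq
      (Eventually.of_forall fun _ => sq_nonneg _)]
    rw [← ENNReal.ofReal_tsum_of_nonneg (fun k => integral_nonneg fun _ => sq_nonneg _) hsum]
    exact ENNReal.ofReal_ne_top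
  filter_upwards [ae_lt_top' (AEMeasurable.tsum hmeas) hfin] with ω hω
  have hsq : Tendsto (fun k => Z k ω ^ 2) atTop (𝓝 0) := by
    have h := (ENNReal.tendsto_toReal ENNReal.zero_ne_top).comp
      (ENNReal.tendsto_atTop_zero_of_tsum_ne_top hω.ne)
    simpa only [Function.comp_def, ENNReal.toReal_ofReal (sq_nonneg _), ENNReal.toReal_zero]
      using h
  rw [tendsto_zero_iff_abs_tendsto_zero]
  have h := (Real.continuous_sqrt.tendsto 0).comp hsq
  simpa only [Function.comp_def, Real.sqrt_sq_eq_abs, Real.sqrt_zero] using h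

variable [IsProbabilityMeasure P]

theorem integrable_uncurry_mul {α : Type*} [MeasurableSpace α] {ν : Measure α} [IsFiniteMeasure ν]
    {G : α → Ω → ℝ} (hmeas : Measurable (Function.uncurry G)) (hG : ∀ t ω, |G t ω| ≤ 1) :
    Integrable (Function.uncurry fun (z : α × α) ω => G z.1 ω * G z.2 ω) ((ν.prod ν).prod P) := by
  refine Integrable.of_bound (C := 1) (Measurable.aestronglyMeasurable ?_)
    (Eventually.of_forall fun x => ?_)
  · exact (hmeas.comp (measurable_fst.fst.prodMk measurable_snd)).mul
      (hmeas.comp (measurable_fst.snd.prodMk measurable_snd))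
  · rw [Function.uncurry_def, norm_mul]
    exact mul_le_one₀ (hG _ _) (norm_nonneg _) (hG _ _)

theorem integral_sq_integral {α : Type*} [MeasurableSpace α] {ν : Measure α} [IsFiniteMeasure ν]
    {G : α → Ω → ℝ} (hmeas : Measurable (Function.uncurry G)) (hG : ∀ t ω, |G t ω| ≤ 1) :
    ∫ ω, (∫ t, G t ω ∂ν) ^ 2 ∂P = ∫ s, ∫ t, ∫ ω, G s ω * G t ω ∂P ∂ν ∂ν := by
  have hintg := integrable_uncurry_mul (P := P) (ν := ν) hmeas hG
  calc _ = ∫ ω, ∫ z, G z.1 ω * G z.2 ω ∂(ν.prod ν) ∂P := by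
        simp only [sq, ← integral_prod_mul]
    _ = ∫ z, ∫ ω, G z.1 ω * G z.2 ω ∂P ∂(ν.prod ν) := (integral_integral_swap hintg).symm
    _ = _ := integral_prod _ hintg.integral_prod_left

variable {G : ℝ → Ω → ℝ} {φ : ℝ → ℝ}

theorem setIntegral_Ioc_sub_add_const_add_le (hφ : Integrable φ) (hφ0 : ∀ x, 0 ≤ φ x) {τ : ℝ}
    (hτ : 0 ≤ τ) (s : ℝ) :
    ∫ t in Set.Ioc 0 τ, (φ (t - s) + φ s + φ t) ≤ 2 * (∫ x, φ x) + τ * φ s := by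
  have hs := hφ.comp_sub_right s
  have hc : IntegrableOn (fun _ => φ s) (Set.Ioc 0 τ) := integrable_const _
  have hsc : IntegrableOn (fun t => φ (t - s) + φ s) (Set.Ioc 0 τ) := hs.integrableOn.add hc
  rw [integral_add hsc hφ.integrableOn, integral_add hs.integrableOn hc, setIntegral_const,
    Real.volume_real_Ioc_of_le hτ, sub_zero, smul_eq_mul]
  have hshift : ∫ t in Set.Ioc 0 τ, φ (t - s) ≤ ∫ x, φ x :=
    (setIntegral_le_integral hs (Eventually.of_forall fun _ => hφ0 _)).trans_eq
      (integral_sub_right_eq_self φ s)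
  linarith [setIntegral_le_integral (s := Set.Ioc 0 τ) hφ (Eventually.of_forall hφ0)]

theorem integral_sq_setIntegral_Ioc_le (hmeas : Measurable (Function.uncurry G))
    (hG : ∀ t ω, |G t ω| ≤ 1) (hφ : Integrable φ) (hφ0 : ∀ x, 0 ≤ φ x)
    (hcov : ∀ s t, 0 ≤ s → 0 ≤ t → ∫ ω, G s ω * G t ω ∂P ≤ φ (t - s) + φ s + φ t)
    {τ : ℝ} (hτ : 0 ≤ τ) :
    ∫ ω, (∫ t in Set.Ioc 0 τ, G t ω) ^ 2 ∂P ≤ 3 * (∫ x, φ x) * τ := by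
  have hintg := (integrable_uncurry_mul (P := P) (ν := volume.restrict (Set.Ioc 0 τ)) hmeas
    hG).integral_prod_left
  rw [integral_sq_integral hmeas hG]
  calc _ ≤ ∫ s in Set.Ioc 0 τ, (2 * (∫ x, φ x) + τ * φ s) := by
        refine integral_mono_ae hintg.integral_prod_left
          ((integrable_const _).add (hφ.integrableOn.const_mul τ)) ?_
        filter_upwards [ae_restrict_mem measurableSet_Ioc, hintg.prod_right_ae] with s hs hsint
        refine (setIntegral_mono_on hsint ?_ measurableSet_Ioc fun t ht =>
          hcov s t hs.1.le ht.1.le).trans (setIntegral_Ioc_sub_add_const_add_le hφ hφ0 hτ s)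
        exact ((hφ.comp_sub_right s).integrableOn.add (integrable_const _)).add hφ.integrableOn
    _ = 2 * (∫ x, φ x) * τ + τ * ∫ s in Set.Ioc 0 τ, φ s := by
        rw [integral_add (integrable_const _) (hφ.integrableOn.const_mul τ), setIntegral_const,
          Real.volume_real_Ioc_of_le hτ, sub_zero, integral_const_mul, smul_eq_mul, mul_comm τ]
    _ ≤ 3 * (∫ x, φ x) * τ := by
        nlinarith [setIntegral_le_integral (s := Set.Ioc 0 τ) hφ (Eventually.of_forall hφ0)]

theorem ae_tendsto_average (hmeas : Measurable (Function.uncurry G))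
    (hG : ∀ t ω, |G t ω| ≤ 1) (hφ : Integrable φ) (hφ0 : ∀ x, 0 ≤ φ x)
    (hcov : ∀ s t, 0 ≤ s → 0 ≤ t → ∫ ω, G s ω * G t ω ∂P ≤ φ (t - s) + φ s + φ t) :
    ∀ᵐ ω ∂P, Tendsto (fun τ : ℝ => τ⁻¹ * ∫ t in (0 : ℝ)..τ, G t ω) atTop (𝓝 0) := by
  set I : ℝ → Ω → ℝ := fun τ ω => ∫ t in (0 : ℝ)..τ, G t ω with hI
  have hLip (ω : Ω) : LipschitzWith 1 fun τ => I τ ω :=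
    lipschitzWith_intervalIntegral (hmeas.comp measurable_prodMk_right) fun t => hG t ω
  have hIoc {τ : ℝ} (hτ : 0 ≤ τ) : I τ = fun ω => ∫ t in Set.Ioc 0 τ, G t ω :=
    funext fun ω => intervalIntegral.integral_of_le hτ
  have hsq (k : ℕ) : (0 : ℝ) ≤ (k : ℝ) ^ 2 := by positivity
  have hmemLp (k : ℕ) : MemLp (fun ω => ((k : ℝ) ^ 2)⁻¹ * I ((k : ℝ) ^ 2) ω) 2 P := by
    refine MemLp.const_mul (MemLp.of_bound ?_ ((k : ℝ) ^ 2) (Eventually.of_forall fun ω => ?_)) _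
    · have h : StronglyMeasurable (Function.uncurry fun ω t => G t ω) :=
        (hmeas.comp measurable_swap).stronglyMeasurable
      exact hIoc (hsq k) ▸ h.integral_prod_right.aestronglyMeasurable
    · have h := (hLip ω).dist_le_mul ((k : ℝ) ^ 2) 0
      simpa [hI] using h
  have hmoment (k : ℕ) : ∫ ω, (((k : ℝ) ^ 2)⁻¹ * I ((k : ℝ) ^ 2) ω) ^ 2 ∂P ≤
      3 * (∫ x, φ x) * ((k : ℝ) ^ 2)⁻¹ := by
    have h := integral_sq_setIntegral_Ioc_le hmeas hG hφ hφ0 hcov (hsq k)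
    simp only [hIoc (hsq k), mul_pow, integral_const_mul]
    refine (mul_le_mul_of_nonneg_left h (by positivity)).trans_eq ?_
    obtain rfl | hk := eq_or_ne k 0
    · simp
    · field_simp
  filter_upwards [ae_tendsto_zero_of_summable_integral_sq hmemLp
    (((Real.summable_nat_pow_inv.2 one_lt_two).mul_left _).of_nonneg_of_le
      (fun k => integral_nonneg fun _ => sq_nonneg _) hmoment)] with ω hω
  exact tendsto_inv_mul_of_lipschitzWith (hLip ω) hω

end TimeAverage

section MeanFreshness

theorem integrable_exp_neg_mul_abs {c : ℝ} (hc : 0 < c) :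
    Integrable fun x : ℝ => Real.exp (-c * |x|) := by
  refine Integrable.of_integral_ne_zero ?_
  rw [integral_comp_abs (f := fun x => Real.exp (-c * x)), integral_exp_mul_Ioi (neg_neg_of_pos hc)]
  simp [hc.ne']

theorem integral_indicator_sub_mul_indicator_sub {Ω : Type*} [MeasurableSpace Ω] {P : Measure Ω}
    [IsProbabilityMeasure P] {A B : Set Ω} (hA : MeasurableSet A) (hB : MeasurableSet B) (m : ℝ) :
    ∫ ω, (A.indicator 1 ω - m) * (B.indicator 1 ω - m) ∂P =
      P.real (A ∩ B) - P.real A * m - m * (P.real B - m) := by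
  have hintg {D : Set Ω} (hD : MeasurableSet D) : Integrable (D.indicator (1 : Ω → ℝ)) P :=
    (integrable_const (1 : ℝ)).indicator hD
  calc _ = ∫ ω, ((A ∩ B).indicator 1 ω - A.indicator 1 ω * m - m * (B.indicator 1 ω - m)) ∂P := by
        refine integral_congr_ae (Eventually.of_forall fun ω => ?_)
        simp only [Set.inter_indicator_one, Pi.mul_apply]
        ring
    _ = ∫ ω, (A ∩ B).indicator 1 ω ∂P - (∫ ω, A.indicator 1 ω ∂P) * m -
          m * (∫ ω, B.indicator 1 ω ∂P - m) := by
        have hAm : Integrable (fun ω => A.indicator (1 : Ω → ℝ) ω * m) P := (hintg hA).mul_const m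
        have hBm : Integrable (fun ω => B.indicator (1 : Ω → ℝ) ω - m) P :=
          (hintg hB).sub (integrable_const m)
        have hABm : Integrable (fun ω => (A ∩ B).indicator (1 : Ω → ℝ) ω - A.indicator 1 ω * m) P :=
          (hintg (hA.inter hB)).sub hAm
        rw [integral_sub hABm (hBm.const_mul m), integral_sub (hintg (hA.inter hB)) hAm,
          integral_mul_const, integral_const_mul, integral_sub (hintg hB) (integrable_const m),
          integral_const, probReal_univ, one_smul]
    _ = _ := by
        rw [integral_indicator_one hA, integral_indicator_one hB,
          integral_indicator_one (hA.inter hB)]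

variable {S : Type*} [Fintype S] [DecidableEq S] [MeasurableSpace S] [MeasurableSingletonClass S]
  [Nonempty S] {Ω : Type*} [MeasurableSpace Ω] {P : Measure Ω} [IsProbabilityMeasure P]
  {Q : Matrix S S ℝ} {r : ℝ≥0} {X : ℝ≥0 → Ω → S} {N : ℝ≥0 → Ω → ℕ} {x₀ : Ω → S} {p : S → ℝ}
  {C δ c : ℝ} {s t : ℝ≥0}

namespace IsPoissonSampled

theorem abs_measureReal_freshEvent_sub_meanFreshness_le (hS : IsPoissonSampled P Q r X N x₀)
    (hr : 0 < r) (hQ : IsMixing Q p C δ) (hp : IsStationary Q p) (hcδ : 2 * c ≤ δ)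
    (hcr : 2 * c ≤ r) (t : ℝ≥0) :
    |P.real (freshEvent X N x₀ t) - meanFreshness Q p r| ≤
      (Fintype.card S * C * (C + 1) + 2 * (C + 1) + 2) * Real.exp (-c * t) := by
  have hC := hQ.nonneg
  have hhalf : t / 2 ≤ t := half_le_self zero_le
  have hfresh := hS.abs_measureReal_freshEvent_sub_le hhalf
  have hsince := hS.abs_measureReal_freshSince_inter_sub_meanFreshness_le hr hQ hp le_rfl
    (zero_le (a := t / 2)) hhalf
  rw [freshSince_self, Set.univ_inter, probReal_univ, one_mul] at hsince
  have := t.coe_nonneg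
  have hδexp : Real.exp (-δ * ((t / 2 : ℝ≥0) - (0 : ℝ≥0))) ≤ Real.exp (-c * t) :=
    Real.exp_le_exp.2 (by push_cast; nlinarith)
  have hrexp : Real.exp (-(r * (t - (t / 2 : ℝ≥0)))) ≤ Real.exp (-c * t) :=
    Real.exp_le_exp.2 (by push_cast; nlinarith)
  calc _ ≤ _ := (abs_sub_le _ _ _).trans (add_le_add hfresh hsince)
    _ ≤ Real.exp (-c * t) + (Fintype.card S * C * (C + 1) * Real.exp (-c * t) +
          2 * (C + 1) * Real.exp (-c * t)) := by gcongr
    _ ≤ _ := by linarith [Real.exp_pos (-c * t)]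

theorem tendsto_measureReal_freshEvent (hS : IsPoissonSampled P Q r X N x₀) (hr : 0 < r)
    (hQ : IsMixing Q p C δ) (hp : IsStationary Q p) :
    Tendsto (fun t => P.real (freshEvent X N x₀ t)) atTop (𝓝 (meanFreshness Q p r)) := by
  have hc : 0 < min δ r / 2 := half_pos (lt_min hQ.rate_pos hr)
  have hdecay : Tendsto (fun t : ℝ≥0 => Real.exp (-(min δ r / 2) * t)) atTop (𝓝 0) :=
    Real.tendsto_exp_atBot.comp
      ((NNReal.tendsto_coe_atTop.2 tendsto_id).const_mul_atTop_of_neg (neg_neg_of_pos hc))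
  refine tendsto_iff_norm_sub_tendsto_zero.2 (squeeze_zero (fun _ => norm_nonneg _)
    (fun t => hS.abs_measureReal_freshEvent_sub_meanFreshness_le (c := min δ r / 2) hr hQ hp
      (by linarith [min_le_left δ (r : ℝ)]) (by linarith [min_le_right δ (r : ℝ)]) t) ?_)
  simpa only [mul_zero] using hdecay.const_mul _

theorem meanFreshness_mem_Icc (hS : IsPoissonSampled P Q r X N x₀) (hr : 0 < r)
    (hQ : IsMixing Q p C δ) (hp : IsStationary Q p) : meanFreshness Q p r ∈ Set.Icc (0 : ℝ) 1 :=
  isClosed_Icc.mem_of_tendsto (hS.tendsto_measureReal_freshEvent hr hQ hp)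
    (Eventually.of_forall fun _ => ⟨measureReal_nonneg, measureReal_le_one⟩)

theorem abs_measureReal_freshEvent_inter_sub_meanFreshness_le
    (hS : IsPoissonSampled P Q r X N x₀) (hr : 0 < r) (hQ : IsMixing Q p C δ)
    (hp : IsStationary Q p) (hc : 0 ≤ c) (hcδ : 2 * c ≤ δ) (hcr : 2 * c ≤ r) (hst : s ≤ t) :
    |P.real (freshEvent X N x₀ s ∩ freshEvent X N x₀ t) -
        P.real (freshEvent X N x₀ s) * meanFreshness Q p r| ≤
      (Fintype.card S * C * (C + 1) + 2 * (C + 1) + 2) *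
        (Real.exp (-c * (t - s)) + Real.exp (-c * s)) := by
  have hC := hQ.nonneg
  set m := meanFreshness Q p r
  have hm : |m| ≤ 1 := abs_le.2 ⟨by linarith [(hS.meanFreshness_mem_Icc hr hQ hp).1],
    (hS.meanFreshness_mem_Icc hr hQ hp).2⟩
  set u : ℝ≥0 := (s + t) / 2
  have hu : (u : ℝ) = (s + t) / 2 := by simp [u]
  have : (s : ℝ) ≤ t := hst
  have hsu : s ≤ u := NNReal.coe_le_coe.1 (by linarith)
  have hut : u ≤ t := NNReal.coe_le_coe.1 (by linarith)
  set ε := Real.exp (-c * (t - s))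
  set η := Real.exp (-c * s)
  have hδε : Real.exp (-δ * (u - s)) ≤ ε := Real.exp_le_exp.2 (by nlinarith)
  have hrε : Real.exp (-(r * (t - u))) ≤ ε := Real.exp_le_exp.2 (by nlinarith)
  have hrη : Real.exp (-(r * (s - (0 : ℝ≥0)))) ≤ η :=
    Real.exp_le_exp.2 (by push_cast; nlinarith [s.coe_nonneg])
  have hfresh := hS.abs_measureReal_freshEvent_inter_sub_le (zero_le (a := s)) hut
  have hsince := hS.abs_measureReal_freshSince_inter_sub_meanFreshness_le hr hQ hp
    (zero_le (a := s)) hsu hut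
  have hstart : |P.real (freshSince X N 0 s) * m - P.real (freshEvent X N x₀ s) * m| ≤ η := by
    rw [← sub_mul, abs_mul, abs_sub_comm]
    exact (mul_le_of_le_one_right (abs_nonneg _) hm).trans
      ((hS.abs_measureReal_freshEvent_sub_le zero_le).trans hrη)
  calc _ ≤ _ := (abs_sub_le _ _ _).trans (add_le_add hfresh
        ((abs_sub_le _ _ _).trans (add_le_add hsince hstart)))
    _ ≤ (η + ε) + (Fintype.card S * C * (C + 1) * ε + 2 * (C + 1) * ε + η) := by gcongr
    _ ≤ _ := by
        have : 0 ≤ (Fintype.card S * C * (C + 1) + 2 * (C + 1)) * η := by positivity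
        linarith [Real.exp_pos (-c * (t - s))]

theorem integral_freshness_sub_mul_le (hS : IsPoissonSampled P Q r X N x₀) (hr : 0 < r)
    (hQ : IsMixing Q p C δ) (hp : IsStationary Q p) (hc : 0 ≤ c) (hcδ : 2 * c ≤ δ)
    (hcr : 2 * c ≤ r) (hst : s ≤ t) :
    ∫ ω, (freshness X N x₀ s ω - meanFreshness Q p r) *
        (freshness X N x₀ t ω - meanFreshness Q p r) ∂P ≤
      (Fintype.card S * C * (C + 1) + 2 * (C + 1) + 2) *
        (Real.exp (-c * (t - s)) + Real.exp (-c * s) + Real.exp (-c * t)) := by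
  simp only [freshness_eq_indicator]
  rw [integral_indicator_sub_mul_indicator_sub (hS.measurableSet_freshEvent s)
    (hS.measurableSet_freshEvent t), mul_add]
  have hm := hS.meanFreshness_mem_Icc hr hQ hp
  have hjoint := hS.abs_measureReal_freshEvent_inter_sub_meanFreshness_le hr hQ hp hc hcδ hcr hst
  have hsingle := hS.abs_measureReal_freshEvent_sub_meanFreshness_le hr hQ hp hcδ hcr t
  have hmul := (abs_mul (meanFreshness Q p r)
    (P.real (freshEvent X N x₀ t) - meanFreshness Q p r)).trans_le
    (mul_le_of_le_one_left (abs_nonneg _) (by rw [abs_of_nonneg hm.1]; exact hm.2))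
  exact (le_abs_self _).trans ((abs_sub _ _).trans (add_le_add hjoint (hmul.trans hsingle)))

theorem integral_freshness_toNNReal_sub_mul_le (hS : IsPoissonSampled P Q r X N x₀) (hr : 0 < r)
    (hQ : IsMixing Q p C δ) (hp : IsStationary Q p) (hc : 0 ≤ c) (hcδ : 2 * c ≤ δ)
    (hcr : 2 * c ≤ r) {s t : ℝ} (hs : 0 ≤ s) (ht : 0 ≤ t) :
    ∫ ω, (freshness X N x₀ s.toNNReal ω - meanFreshness Q p r) *
        (freshness X N x₀ t.toNNReal ω - meanFreshness Q p r) ∂P ≤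
      (Fintype.card S * C * (C + 1) + 2 * (C + 1) + 2) *
        (Real.exp (-c * |t - s|) + Real.exp (-c * |s|) + Real.exp (-c * |t|)) := by
  wlog hst : s ≤ t generalizing s t
  · simpa only [mul_comm, abs_sub_comm, add_right_comm] using this ht hs (le_of_not_ge hst)
  have h := hS.integral_freshness_sub_mul_le hr hQ hp hc hcδ hcr (Real.toNNReal_le_toNNReal hst)
  rw [abs_of_nonneg (sub_nonneg.2 hst), abs_of_nonneg hs, abs_of_nonneg ht]
  rwa [Real.coe_toNNReal s hs, Real.coe_toNNReal t ht] at h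

theorem ae_tendsto_average_freshness (hS : IsPoissonSampled P Q r X N x₀) (hr : 0 < r)
    (hQ : IsMixing Q p C δ) (hp : IsStationary Q p) :
    ∀ᵐ ω ∂P, Tendsto (fun τ : ℝ => τ⁻¹ * ∫ t in (0 : ℝ)..τ, freshness X N x₀ t.toNNReal ω) atTop
      (𝓝 (meanFreshness Q p r)) := by
  set m := meanFreshness Q p r
  have hc : 0 < min δ r / 2 := half_pos (lt_min hQ.rate_pos hr)
  have hC := hQ.nonneg
  have hmeas : Measurable (Function.uncurry fun (t : ℝ) ω => freshness X N x₀ t.toNNReal ω) :=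
    hS.measurable_uncurry_freshness.comp
      ((measurable_real_toNNReal.comp measurable_fst).prodMk measurable_snd)
  have hmem (t : ℝ≥0) (ω : Ω) : freshness X N x₀ t ω ∈ Set.Icc (0 : ℝ) 1 := by
    rw [freshness]
    split <;> simp
  have hm : m ∈ Set.Icc (0 : ℝ) 1 := hS.meanFreshness_mem_Icc hr hQ hp
  have hcentred := ae_tendsto_average (P := P)
    (G := fun t ω => freshness X N x₀ t.toNNReal ω - m) (hmeas.sub_const m)
    (fun t ω => Real.dist_le_of_mem_Icc_01 (hmem t.toNNReal ω) hm)
    ((integrable_exp_neg_mul_abs hc).const_mul (Fintype.card S * C * (C + 1) + 2 * (C + 1) + 2))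
    (fun x => by positivity) fun s t hs ht => by
      simpa only [mul_add] using hS.integral_freshness_toNNReal_sub_mul_le hr hQ hp hc.le
        (by linarith [min_le_left δ (r : ℝ)]) (by linarith [min_le_right δ (r : ℝ)]) hs ht
  filter_upwards [hcentred] with ω hω
  have hshift := hω.add_const m
  rw [zero_add] at hshift
  refine hshift.congr' ?_
  filter_upwards [eventually_gt_atTop 0] with τ hτ
  have hintg : IntervalIntegrable (fun t : ℝ => freshness X N x₀ t.toNNReal ω) volume 0 τ :=
    (intervalIntegrable_const (c := (1 : ℝ))).mono_fun'
      (hmeas.comp measurable_prodMk_right).aestronglyMeasurable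
      (Eventually.of_forall fun t => (Real.norm_of_nonneg (hmem _ ω).1).trans_le (hmem _ ω).2)
  rw [intervalIntegral.integral_sub hintg intervalIntegrable_const, intervalIntegral.integral_const,
    sub_zero, smul_eq_mul]
  field_simp
  ring

theorem isMeanFreshness (hS : IsPoissonSampled P Q r X N x₀) (hr : 0 < r)
    (hQ : IsMixing Q p C δ) (hp : IsStationary Q p) :
    IsMeanFreshness P X N x₀ (meanFreshness Q p r) :=
  ⟨hS.tendsto_measureReal_freshEvent hr hQ hp, hS.ae_tendsto_average_freshness hr hQ hp⟩

end IsPoissonSampled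

end MeanFreshness

end SampledCTMC

theorem corollary2 (n : ℕ)
    (Q : Matrix (Fin (n + 1)) (Fin (n + 1)) ℝ) (p : Fin (n + 1) → ℝ)
    (hQ : SampledCTMC.IsGenerator Q) (hirr : SampledCTMC.IsIrreducible Q)
    (hp : SampledCTMC.IsStationary Q p) (hrev : SampledCTMC.IsReversible Q p)
    (U : Matrix (Fin (n + 1)) (Fin (n + 1)) ℝ) (d : Fin n → ℝ)
    (hU : Uᵀ * U = 1)
    (hdiag : Uᵀ * SampledCTMC.symmetrizedGenerator Q p * U =
      Matrix.diagonal (Fin.snoc (α := fun _ => ℝ) (fun j => -d j) 0))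
    (T : Matrix (Fin (n + 1)) (Fin (n + 1)) ℝ) (hT : T = SampledCTMC.diagonalizer p U)
    (a b : Fin n → ℝ)
    (hb : ∀ j, b j = ∑ i, p i ^ 2 * T i j.castSucc ^ 2)
    (ha : ∀ j, a j = b j * d j) :
    (∀ j, b j = ∑ i, T⁻¹ j.castSucc i ^ 2) ∧
    (∀ j, 0 < d j ∧ 0 < b j ∧ 0 < a j) ∧
    ∃ f : ℝ → ℝ,
      (∀ r : ℝ≥0, 0 < r → ∀ (Ω : Type u) [MeasurableSpace Ω] (P : Measure Ω)
        [IsProbabilityMeasure P] (X : ℝ≥0 → Ω → Fin (n + 1)) (N : ℝ≥0 → Ω → ℕ)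
        (x₀ : Ω → Fin (n + 1)), SampledCTMC.IsPoissonSampled P Q r X N x₀ →
          SampledCTMC.IsMeanFreshness P X N x₀ (f r)) ∧
      (∀ r : ℝ, 0 < r → f r = (∑ i, p i ^ 2) + r * ∑ j, b j / (r + d j)) ∧
      (∀ r : ℝ, 0 < r → f r = 1 - ∑ j, a j / (r + d j)) ∧
      (1 ≤ n → StrictMonoOn f (Set.Ioi 0) ∧ StrictConcaveOn ℝ (Set.Ioi 0) f) ∧
      DifferentiableOn ℝ f (Set.Ioi 0) ∧ ContinuousOn (deriv f) (Set.Ioi 0) ∧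
      Tendsto f (𝓝[>] 0) (𝓝 (∑ i, p i ^ 2)) := by
  have hpos := hp.pos hirr hrev
  have h := SampledCTMC.isEigenbasis_diagonalizer hpos hU hdiag
  rw [← hT] at h
  obtain rfl : b = fun j => SampledCTMC.returnWeight p T j.castSucc := funext hb
  obtain rfl : a = fun j => SampledCTMC.returnWeight p T j.castSucc * d j := funext ha
  have hd := h.decayRate_pos hQ hirr hp hpos
  have hbpos (j : Fin n) := h.returnWeight_pos hpos j.castSucc
  have hapos (j : Fin n) := mul_pos (hbpos j) (hd j)
  have hsum := h.sum_sq_add_sum_returnWeight hQ hirr hp hpos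
  obtain ⟨C, δ, hmix⟩ := h.exists_isMixing hQ hirr hp hpos (k := Fin.last n) (by simp)
  refine ⟨fun j => h.returnWeight_eq_sum_inv j.castSucc, fun j => ⟨hd j, hbpos j, hapos j⟩,
    SampledCTMC.freshnessCurve _ d, fun r hr Ω _ P _ X N x₀ hS => ?_,
    fun r hr => SampledCTMC.freshnessCurve_mul_eq hd hsum hr, fun _ _ => rfl, fun hn => ?_, ?_, ?_,
    SampledCTMC.tendsto_freshnessCurve_mul hd hsum⟩
  · simpa only [h.meanFreshness_eq_freshnessCurve hQ hirr hp hpos (NNReal.coe_pos.2 hr)] using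
      hS.isMeanFreshness hr hmix hp
  · have : Nonempty (Fin n) := ⟨⟨0, hn⟩⟩
    exact ⟨SampledCTMC.strictMonoOn_freshnessCurve hapos hd,
      SampledCTMC.strictConcaveOn_freshnessCurve hapos hd⟩
  · exact (SampledCTMC.contDiffOn_freshnessCurve hd).differentiableOn one_ne_zero
  · exact (SampledCTMC.contDiffOn_freshnessCurve hd).continuousOn_deriv_of_isOpen isOpen_Ioi le_rfl
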